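/- Let $E:[0,\infty)\times\mathbb R^2\to\mathbb R^2$ be an electric field. Write $v^\perp=(-v_2,v_1)$ for $v=(v_1,v_2)\in\mathbb R^2$ and let $\|\cdot\|$ be the Euclidean norm on $\mathbb R^2$. For $\varepsilon>0$ and initial data $x^0,v^0\in\mathbb R^2$ let $(x_\varepsilon,v_\varepsilon)$ be the solution on $[0,\infty)$ of $$\varepsilon x_\varepsilon'(t)=v_\varepsilon(t),\qquad \varepsilon v_\varepsilon'(t)=E(t,x_\varepsilon(t))-\frac{v_\varepsilon^\perp(t)}{\varepsilon},\qquad x_\varepsilon(0)=x^0,\quad v_\varepsilon(0)=v^0,$$ and set $y_\varepsilon(t)=x_\varepsilon(t)-\varepsilon v_\varepsilon^\perp(t)$. For a time step $\Delta t>0$ put $t_n=n\Delta t$ and consider the scheme, for $n\ge 0$, $$\frac{v_\varepsilon^{n+1}-v_\varepsilon^n}{\Delta t}=\frac1\varepsilon E\big(t_n,y_\varepsilon^n+\varepsilon(v_\varepsilon^n)^\perp\big)-\frac1{\varepsilon^2}(v_\varepsilon^{n+1})^\perp,\qquad \frac{y_\varepsilon^{n+1}-y_\varepsilon^n}{\Delta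 t}=-E^\perp\big(t_n,y_\varepsilon^n+\varepsilon(v_\varepsilon^{n+1})^\perp\big),$$ started from $v_\varepsilon^0=v^0$, $y_\varepsilon^0=x^0-\varepsilon(v^0)^\perp$; put $x_\varepsilon^n=y_\varepsilon^n+\varepsilon(v_\varepsilon^n)^\perp$. **Theorem.** For all $\varepsilon,\Delta t>0$ and all $x^0,v^0$, the scheme possesses a unique solution $(y_\varepsilon^n,v_\varepsilon^n)_{n\ge0}$. Moreover: (i) If $E\in W^{1,\infty}((0,\infty)\times\mathbb R^2)$ (all first weak derivatives in $(t,x)$, and $E$ itself, are essentially bounded; $E$ is its representative that is continuous on $[0,\infty)\times\mathbb R^2$), and $K_x=\|D_xE\|_{L^\infty}$ (Euclidean operator norm), then there is a constant $C$ depending only on $E$ such that for all $n\ge0$, $\Delta t>0$, $\varepsilon>0$, $x^0,v^0\in\mathbb R^2$, $$\|x_\varepsilon^n-x_\varepsilon(t_n)\|\le C\,(1+t_n^3)\,e^{(2+K_x\Delta t)K_xt_n}\,(1+\|v^0\|+\varepsilon)\,\min\Big(\frac{\Delta t}{\varepsilon^3}(1+\varepsilon^2),\ \Delta t+\varepsilon\Big).$$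 (ii) If $E\in W^{2,\infty}((0,\infty)\times\mathbb R^2)$ (all weak derivatives in $(t,x)$ up to order two are essentially bounded; $E$ continuous as in (i)), then, with $K_x$ as in (i), there is a constant $C$ depending only on $E$ such that for all $n\ge0$, $\Delta t>0$, $\varepsilon>0$, $x^0,v^0\in\mathbb R^2$, $$\|y_\varepsilon^n-y_\varepsilon(t_n)\|\le C\,(1+t_n^4)\,e^{(2+K_x\Delta t)K_xt_n}\,(1+\|v^0\|^2+\varepsilon^2)\,\min\Big(\frac{\Delta t}{\varepsilon^3}(1+\varepsilon),\ \Delta t+\varepsilon^2\Big).$$ -/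

import Mathlib

open MeasureTheory Set
open scoped ENNReal ContDiff

/-- The Euclidean plane `ℝ²`. -/
abbrev Plane : Type := EuclideanSpace ℝ (Fin 2)

/-- Points `(t, x)` of time and space. -/
abbrev SpaceTime : Type := ℝ × Plane

/-- The rotation `v^⊥ = J v = (-v₂, v₁)`. -/
noncomputable def perp (v : Plane) : Plane := !₂[-(v 1), v 0]

section Sobolev

variable {F : Type} [NormedAddCommGroup F] [NormedSpace ℝ F]

/-- The open half space `(0, ∞) × ℝ²` of positive times. -/
def positiveTimes : Set SpaceTime := Ioi 0 ×ˢ univ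

/-- `g` is the weak (distributional) total derivative of `f` on `(0, ∞) × ℝ²`: integration by
parts against all smooth `φ` with compact support inside this open set, in all directions `w`. -/
def IsWeakDeriv (f : SpaceTime → F) (g : SpaceTime → SpaceTime →L[ℝ] F) : Prop :=
  LocallyIntegrableOn f positiveTimes ∧ LocallyIntegrableOn g positiveTimes ∧
    ∀ φ : SpaceTime → ℝ, ContDiff ℝ ∞ φ → HasCompactSupport φ → tsupport φ ⊆ positiveTimes →
      ∀ w : SpaceTime,
        ∫ z in positiveTimes, (fderiv ℝ φ z w) • f z = -∫ z in positiveTimes, φ z • g z w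

open Classical in
/-- The weak total derivative (a representative of it, all of them being equal almost everywhere
on `(0, ∞) × ℝ²`); it is `0` by convention if there is none. -/
noncomputable def weakDeriv (f : SpaceTime → F) : SpaceTime → SpaceTime →L[ℝ] F :=
  if h : ∃ g, IsWeakDeriv f g then h.choose else 0

/-- Essential boundedness on `(0, ∞) × ℝ²`. -/
def MemLInfty (f : SpaceTime → F) : Prop :=
  MemLp f ∞ (volume.restrict positiveTimes)

/-- The `L^∞` norm on `(0, ∞) × ℝ²`. -/
noncomputable def lInftyNorm (f : SpaceTime → F) : ℝ :=
  (eLpNorm f ∞ (volume.restrict positiveTimes)).toReal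

end Sobolev

/-- The Sobolev space `W^{k,∞}((0, ∞) × ℝ²; F)`: all weak derivatives in `(t, x)` up to order `k`
exist and are essentially bounded. -/
def MemSobolevInfty : ℕ → ∀ {F : Type} [NormedAddCommGroup F] [NormedSpace ℝ F],
    (SpaceTime → F) → Prop
  | 0, _, _, _, f => MemLInfty f
  | k + 1, _, _, _, f =>
      MemLInfty f ∧ (∃ g, IsWeakDeriv f g) ∧ MemSobolevInfty k (weakDeriv f)

/-- An electric field on `[0, ∞) × ℝ²` of class `W^{k,∞}`. Since the field is evaluated pointwise
(also at time `0`), `E` has to be the representative that is continuous up to `t = 0`. -/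
def IsSobolevField (k : ℕ) (E : SpaceTime → Plane) : Prop :=
  ContinuousOn E (Ici 0 ×ˢ univ) ∧ MemSobolevInfty k E

/-- `K_x = ‖D_x E‖_{L^∞}`, with the operator norm for the Euclidean norm of `ℝ²`. -/
noncomputable def Kx (E : SpaceTime → Plane) : ℝ :=
  lInftyNorm fun z => (weakDeriv E z).comp (ContinuousLinearMap.inr ℝ ℝ Plane)

/-- `(x, v)` solves, for all `t ≥ 0`, the characteristic system
`ε x' = v`, `ε v' = E(t, x) - v^⊥ / ε` with `x(0) = x₀`, `v(0) = v₀`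
(one-sided derivatives at `t = 0`). -/
structure IsCharacteristic (E : SpaceTime → Plane) (ε : ℝ) (x₀ v₀ : Plane)
    (x v : ℝ → Plane) : Prop where
  init_x : x 0 = x₀
  init_v : v 0 = v₀
  deriv_x : ∀ t : ℝ, 0 ≤ t → HasDerivWithinAt x (ε⁻¹ • v t) (Ici 0) t
  deriv_v : ∀ t : ℝ, 0 ≤ t →
    HasDerivWithinAt v (ε⁻¹ • (E (t, x t) - ε⁻¹ • perp (v t))) (Ici 0) t

/-- `(y n, v n)` solves the first-order IMEX scheme written on the guiding center variable, with
time step `Δt`, `t_n = n Δt`, started from `v⁰ = v₀` and `y⁰ = x₀ - ε v₀^⊥`. -/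
structure IsScheme (E : SpaceTime → Plane) (ε Δt : ℝ) (x₀ v₀ : Plane)
    (y v : ℕ → Plane) : Prop where
  init_y : y 0 = x₀ - ε • perp v₀
  init_v : v 0 = v₀
  step_v : ∀ n : ℕ, Δt⁻¹ • (v (n + 1) - v n) =
    ε⁻¹ • E (n * Δt, y n + ε • perp (v n)) - (ε ^ 2)⁻¹ • perp (v (n + 1))
  step_y : ∀ n : ℕ, Δt⁻¹ • (y (n + 1) - y n) =
    -perp (E (n * Δt, y n + ε • perp (v (n + 1))))

/-!
The scheme treats the rotation `v ↦ v^⊥ / ε²` implicitly. Since `‖v‖ ≤ ‖v + a v^⊥‖` for every real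
`a`, it is stable uniformly in `ε`, and the velocity relative to the drift `-ε E^⊥` satisfies a
discrete and a continuous Gronwall inequality; hence `v` and `v^n` are bounded by a multiple of
`‖v₀‖ + ε`, up to a factor growing with time.

For `Δt ≪ ε³` the scheme is a consistent discretisation of the characteristic system. For small `ε`
both the scheme and the guiding center `y = x - ε v^⊥` are perturbations, of size `ε ‖v‖`, of the
explicit Euler scheme for the limit equation `y' = -E^⊥(t, y)`, which gives the error `Δt + ε`.
One order is gained on `y` because the term `ε D_xE^⊥(t, y) v^⊥` in the expansion of
`E^⊥(t, y + ε v^⊥)` oscillates: as `v^⊥ = ε E - ε² v'`, it is, up to `O(ε²)`, the derivative of a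
corrector of size `ε³ ‖v‖`, and likewise for the scheme. The corrector involves `D_xE` and is
differentiated along the motion, so `E` is first mollified.
-/

section BumpIntegrals

variable {G F : Type*} [NormedAddCommGroup G] [NormedSpace ℝ G] [FiniteDimensional ℝ G]
  [MeasurableSpace G] [BorelSpace G] {μ : Measure G} [μ.IsAddHaarMeasure] [NormedAddCommGroup F]

theorem integrable_normed_sub (φ : ContDiffBump (0 : G)) (x : G) :
    Integrable (fun w => φ.normed μ (x - w)) μ :=
  φ.integrable_normed.comp_sub_left x

theorem tsupport_normed_sub_subset (φ : ContDiffBump (0 : G)) (x : G) :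
    tsupport (fun w => φ.normed μ (x - w)) ⊆ Metric.closedBall x φ.rOut := by
  refine closure_minimal (fun w hw => ?_) Metric.isClosed_closedBall
  have hw : x - w ∈ Function.support (φ.normed μ) := hw
  rw [φ.support_normed_eq, mem_ball_zero_iff] at hw
  rw [mem_closedBall_iff_norm']
  exact hw.le

theorem setIntegral_normed_sub_le_one (φ : ContDiffBump (0 : G)) (s : Set G) (x : G) :
    ∫ w in s, φ.normed μ (x - w) ∂μ ≤ 1 :=
  calc ∫ w in s, φ.normed μ (x - w) ∂μ
      ≤ ∫ w, φ.normed μ (x - w) ∂μ :=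
        setIntegral_le_integral (integrable_normed_sub φ x) (.of_forall fun _ => φ.nonneg_normed _)
    _ = 1 := by rw [integral_sub_left_eq_self (fun w => φ.normed μ w) μ x, φ.integral_normed]

variable [NormedSpace ℝ F]

theorem norm_setIntegral_normed_smul_le (φ : ContDiffBump (0 : G)) {s : Set G} {f : G → F} {c : ℝ}
    (hc : 0 ≤ c) (hf : ∀ᵐ w ∂(μ.restrict s), ‖f w‖ ≤ c) (x : G) :
    ‖∫ w in s, φ.normed μ (x - w) • f w ∂μ‖ ≤ c :=
  calc ‖∫ w in s, φ.normed μ (x - w) • f w ∂μ‖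
      ≤ ∫ w in s, φ.normed μ (x - w) * c ∂μ := by
        refine norm_integral_le_of_norm_le ((integrable_normed_sub φ x).integrableOn.mul_const c) ?_
        filter_upwards [hf] with w hw
        rw [norm_smul, Real.norm_of_nonneg (φ.nonneg_normed _)]
        exact mul_le_mul_of_nonneg_left hw (φ.nonneg_normed _)
    _ = (∫ w in s, φ.normed μ (x - w) ∂μ) * c := integral_mul_const _ _
    _ ≤ c := mul_le_of_le_one_left hc (setIntegral_normed_sub_le_one φ s x)

end BumpIntegrals

section Mollification

open Filter Topology

instance isAddHaarMeasure_spaceTime : (volume : Measure SpaceTime).IsAddHaarMeasure :=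
  inferInstanceAs ((volume : Measure ℝ).prod (volume : Measure Plane)).IsAddHaarMeasure

theorem isOpen_positiveTimes : IsOpen positiveTimes := isOpen_Ioi.prod isOpen_univ

theorem mem_positiveTimes {z : SpaceTime} : z ∈ positiveTimes ↔ 0 < z.1 := by
  simp [positiveTimes]

variable {F : Type} [NormedAddCommGroup F] {f : SpaceTime → F}

theorem lInftyNorm_nonneg (f : SpaceTime → F) : 0 ≤ lInftyNorm f := ENNReal.toReal_nonneg

theorem MemLInfty.ae_norm_le (hf : MemLInfty f) :
    ∀ᵐ z ∂(volume.restrict positiveTimes), ‖f z‖ ≤ lInftyNorm f := by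
  filter_upwards [enorm_ae_le_eLpNormEssSup f (volume.restrict positiveTimes)] with z hz
  rw [← eLpNorm_exponent_top] at hz
  simpa [lInftyNorm] using ENNReal.toReal_mono hf.2.ne hz

theorem MemLInfty.locallyIntegrable_indicator (hf : MemLInfty f) :
    LocallyIntegrable (positiveTimes.indicator f) :=
  ((memLp_indicator_iff_restrict isOpen_positiveTimes.measurableSet).2 hf).locallyIntegrable le_top

variable [NormedSpace ℝ F]

theorem IsWeakDeriv.weakDeriv (h : ∃ g, IsWeakDeriv f g) : IsWeakDeriv f (weakDeriv f) := by
  rw [_root_.weakDeriv, dif_pos h]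
  exact h.choose_spec

theorem MemLInfty.integrableOn_normed_smul (hf : MemLInfty f) (φ : ContDiffBump (0 : SpaceTime))
    (x : SpaceTime) : IntegrableOn (fun w => φ.normed volume (x - w) • f w) positiveTimes :=
  (integrable_normed_sub φ x).integrableOn.smul_of_top_left hf

/-- The mollification of `f` by `φ`, evaluated at a point shifted by `2 φ.rOut` to the future, so
that on all nonnegative times it only involves values of `f` at positive times. -/
noncomputable def mollify (φ : ContDiffBump (0 : SpaceTime)) (f : SpaceTime → F)
    (z : SpaceTime) : F :=
  ∫ w in positiveTimes, φ.normed volume (z + (2 * φ.rOut, 0) - w) • f w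

variable {φ : ContDiffBump (0 : SpaceTime)}

theorem mollify_eq_convolution (φ : ContDiffBump (0 : SpaceTime)) (f : SpaceTime → F) :
    mollify φ f = fun z => convolution (positiveTimes.indicator f) (φ.normed volume)
      (ContinuousLinearMap.lsmul ℝ ℝ).flip volume (z + (2 * φ.rOut, 0)) := by
  ext z
  rw [mollify, convolution_def, ← integral_indicator isOpen_positiveTimes.measurableSet]
  congr 1 with w
  by_cases hw : w ∈ positiveTimes <;> simp [hw]

theorem mollify_apply_apply {g : SpaceTime → SpaceTime →L[ℝ] F} (hg : MemLInfty g)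
    (z h : SpaceTime) : mollify φ g z h = mollify φ (fun w => g w h) z := by
  rw [mollify, ContinuousLinearMap.integral_apply (hg.integrableOn_normed_smul φ _)]
  rfl

theorem norm_mollify_le {c : ℝ} (hc : 0 ≤ c)
    (hf : ∀ᵐ z ∂(volume.restrict positiveTimes), ‖f z‖ ≤ c) (z : SpaceTime) :
    ‖mollify φ f z‖ ≤ c :=
  norm_setIntegral_normed_smul_le φ hc hf _

theorem contDiff_mollify (hf : MemLInfty f) : ContDiff ℝ ∞ (mollify φ f) := by
  rw [mollify_eq_convolution]
  exact (φ.hasCompactSupport_normed.contDiff_convolution_right _ hf.locallyIntegrable_indicator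
    φ.contDiff_normed).comp (contDiff_id.add contDiff_const)

theorem fderiv_mollify_apply (hf : MemLInfty f) (z h : SpaceTime) :
    fderiv ℝ (mollify φ f) z h =
      ∫ w in positiveTimes, fderiv ℝ (φ.normed volume) (z + (2 * φ.rOut, 0) - w) h • f w := by
  have hφ : ContDiff ℝ 1 (φ.normed (volume : Measure SpaceTime)) := φ.contDiff_normed
  rw [mollify_eq_convolution, fderiv_comp_add_right,
    (φ.hasCompactSupport_normed.hasFDerivAt_convolution_right _
      hf.locallyIntegrable_indicator hφ _).fderiv,
    convolution_precompR_apply _ hf.locallyIntegrable_indicator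
      (φ.hasCompactSupport_normed.fderiv (𝕜 := ℝ)) (hφ.continuous_fderiv one_ne_zero),
    convolution_def, ← integral_indicator isOpen_positiveTimes.measurableSet]
  congr 1 with w
  by_cases hw : w ∈ positiveTimes <;> simp [hw]

theorem fderiv_mollify {g : SpaceTime → SpaceTime →L[ℝ] F} (hf : MemLInfty f) (hg : MemLInfty g)
    (hfg : IsWeakDeriv f g) {z : SpaceTime} (hz : -φ.rOut < z.1) :
    fderiv ℝ (mollify φ f) z = mollify φ g z := by
  refine ContinuousLinearMap.ext fun h => ?_
  set x := z + (2 * φ.rOut, 0) with hx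
  have hψ : ContDiff ℝ ∞ (φ.normed (volume : Measure SpaceTime)) := φ.contDiff_normed
  have hderiv : ∀ w, fderiv ℝ (fun w => φ.normed volume (x - w)) w h =
      -fderiv ℝ (φ.normed volume) (x - w) h := fun w => by
    have hcomp : HasFDerivAt (fun w => φ.normed volume (x - w)) _ w :=
      ((hψ.differentiable (by simp)) (x - w)).hasFDerivAt.comp w ((hasFDerivAt_id w).const_sub x)
    simp [hcomp.fderiv]
  have hball : Metric.closedBall x φ.rOut ⊆ positiveTimes := fun w hw => by
    rw [mem_closedBall_iff_norm] at hw
    have := abs_le.1 ((norm_fst_le (w - x)).trans hw)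
    simp only [hx, Prod.fst_sub, Prod.fst_add] at this
    exact mem_positiveTimes.2 (by linarith)
  have hparts := hfg.2.2 (fun w => φ.normed volume (x - w))
    (hψ.comp (contDiff_const.sub contDiff_id))
    (.of_support_subset_isCompact (isCompact_closedBall x φ.rOut)
      ((subset_tsupport _).trans (tsupport_normed_sub_subset φ x)))
    ((tsupport_normed_sub_subset φ x).trans hball) h
  simp only [hderiv, neg_smul, integral_neg, neg_inj] at hparts
  rw [fderiv_mollify_apply hf, mollify_apply_apply hg]
  exact hparts

theorem norm_mollify_sub_le [CompleteSpace F] (hf : MemLInfty f) {z : SpaceTime} (hz : 0 ≤ z.1)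
    {c : F} {η : ℝ} (hη : 0 ≤ η)
    (h : ∀ w : SpaceTime, 0 < w.1 → ‖w - z‖ < 3 * φ.rOut → ‖f w - c‖ ≤ η) :
    ‖mollify φ f z - c‖ ≤ η := by
  rw [← dist_eq_norm, mollify_eq_convolution, convolution_flip]
  refine dist_convolution_le hη φ.support_normed_eq.subset φ.nonneg_normed φ.integral_normed
    hf.locallyIntegrable_indicator.aestronglyMeasurable fun w hw => ?_
  rw [mem_ball_iff_norm] at hw
  have htime := abs_lt.1 ((norm_fst_le _).trans_lt hw)
  have hspace := (norm_snd_le _).trans_lt hw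
  simp only [Prod.fst_sub, Prod.fst_add, Prod.snd_sub, Prod.snd_add, add_zero] at htime hspace
  have hr := φ.rOut_pos
  have hw0 : 0 < w.1 := by linarith
  have hwz : ‖w - z‖ < 3 * φ.rOut :=
    max_lt (abs_lt.2 ⟨by simp only [Prod.fst_sub]; linarith, by simp only [Prod.fst_sub]; linarith⟩)
      (by simp only [Prod.snd_sub]; linarith)
  rw [indicator_of_mem (mem_positiveTimes.2 hw0), dist_eq_norm]
  exact h w hw0 hwz

theorem tendsto_mollify [CompleteSpace F] {ι : Type*} {l : Filter ι}
    {φ : ι → ContDiffBump (0 : SpaceTime)} (hφ : Tendsto (fun i => (φ i).rOut) l (𝓝 0))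
    (hf : MemLInfty f) (hc : ContinuousOn f (Ici 0 ×ˢ univ)) {z : SpaceTime} (hz : 0 ≤ z.1) :
    Tendsto (fun i => mollify (φ i) f z) l (𝓝 (f z)) := by
  refine Metric.nhds_basis_closedBall.tendsto_right_iff.2 fun η hη => ?_
  obtain ⟨ρ, hρ, hfρ⟩ := Metric.continuousWithinAt_iff.1 (hc z (by simpa using hz)) η hη
  filter_upwards [hφ.eventually_lt_const (div_pos hρ three_pos)] with i hi
  rw [mem_closedBall_iff_norm]
  refine norm_mollify_sub_le hf hz hη.le fun w hw hwz => ?_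
  rw [← dist_eq_norm]
  exact (hfρ (by simpa using hw.le) (by rw [dist_eq_norm]; linarith)).le

/-- The bump function that equals `1` on the ball of radius `δ / 2` and vanishes outside the one of
radius `δ`. -/
noncomputable def bumpOfRadius (δ : ℝ) (hδ : 0 < δ) : ContDiffBump (0 : SpaceTime) :=
  ⟨δ / 2, δ, half_pos hδ, half_lt_self hδ⟩

end Mollification

section SobolevFields

open Filter Topology

/-- Regularity of a field on nonnegative times: bounded by `M`, Lipschitz with constant `L` in time
and with constant `K` in space. -/
structure IsLipField (E : SpaceTime → Plane) (M L K : ℝ) : Prop where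
  bound : ∀ t x, 0 ≤ t → ‖E (t, x)‖ ≤ M
  lip_t : ∀ s t x, 0 ≤ s → 0 ≤ t → ‖E (s, x) - E (t, x)‖ ≤ L * |s - t|
  lip_x : ∀ t x y, 0 ≤ t → ‖E (t, x) - E (t, y)‖ ≤ K * ‖x - y‖

/-- A smooth field `e` that on nonnegative times is `δ`-close to `E`, has spatial derivative at
most `K`, and second derivative in `(t, x)` at most `H`. -/
structure IsSmoothApprox (E e : SpaceTime → Plane) (K H δ : ℝ) : Prop where
  contDiff : ContDiff ℝ ∞ e
  close : ∀ z : SpaceTime, 0 ≤ z.1 → ‖E z - e z‖ ≤ δ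
  bound_fderiv : ∀ z : SpaceTime, 0 ≤ z.1 → ∀ h, ‖fderiv ℝ e z (0, h)‖ ≤ K * ‖h‖
  bound_fderiv_fderiv : ∀ z : SpaceTime, 0 ≤ z.1 → ‖fderiv ℝ (fderiv ℝ e) z‖ ≤ H

theorem norm_sub_le_of_norm_fderiv_time_le {F : Type*} [NormedAddCommGroup F] [NormedSpace ℝ F]
    {e : SpaceTime → F} (he : Differentiable ℝ e) {S : Set ℝ} (hS : Convex ℝ S) {L : ℝ} {x : Plane}
    (hL : ∀ t ∈ S, ‖fderiv ℝ e (t, x) (1, 0)‖ ≤ L) {s t : ℝ} (hs : s ∈ S) (ht : t ∈ S) :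
    ‖e (s, x) - e (t, x)‖ ≤ L * |s - t| :=
  hS.norm_image_sub_le_of_norm_hasDerivWithin_le (fun r _ =>
    ((he (r, x)).hasFDerivAt.comp_hasDerivAt r
      ((hasDerivAt_id r).prodMk (hasDerivAt_const r x))).hasDerivWithinAt) hL ht hs

theorem norm_sub_le_of_norm_fderiv_space_le {F : Type*} [NormedAddCommGroup F] [NormedSpace ℝ F]
    {e : SpaceTime → F} (he : Differentiable ℝ e) {K t : ℝ} (hK : 0 ≤ K)
    (hbound : ∀ x h : Plane, ‖fderiv ℝ e (t, x) (0, h)‖ ≤ K * ‖h‖) (x y : Plane) :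
    ‖e (t, x) - e (t, y)‖ ≤ K * ‖x - y‖ :=
  convex_univ.norm_image_sub_le_of_norm_hasFDerivWithin_le (fun w _ =>
    ((he (t, w)).hasFDerivAt.comp w (hasFDerivAt_prodMk_right t w)).hasFDerivWithinAt)
    (fun w _ => ContinuousLinearMap.opNorm_le_bound _ hK fun h => by simpa using hbound w h)
    (mem_univ y) (mem_univ x)

theorem Kx_nonneg (E : SpaceTime → Plane) : 0 ≤ Kx E := lInftyNorm_nonneg _

variable {E : SpaceTime → Plane} {φ : ContDiffBump (0 : SpaceTime)}

theorem ae_norm_weakDeriv_space_le (hD : MemLInfty (weakDeriv E)) :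
    ∀ᵐ z ∂(volume.restrict positiveTimes), ∀ h : Plane,
      ‖weakDeriv E z (0, h)‖ ≤ Kx E * ‖h‖ := by
  have hm : MemLInfty fun z => (weakDeriv E z).comp (ContinuousLinearMap.inr ℝ ℝ Plane) :=
    ((ContinuousLinearMap.compL ℝ Plane SpaceTime Plane).flip
      (ContinuousLinearMap.inr ℝ ℝ Plane)).comp_memLp' hD
  filter_upwards [hm.ae_norm_le] with z hz h
  simpa [Kx] using ContinuousLinearMap.le_of_opNorm_le _ hz h

theorem IsSobolevField.one_of_two (hE : IsSobolevField 2 E) : IsSobolevField 1 E :=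
  ⟨hE.1, hE.2.1, hE.2.2.1, hE.2.2.2.1⟩

theorem IsSobolevField.norm_fderiv_mollify_time_le (hE : IsSobolevField 1 E) {z : SpaceTime}
    (hz : 0 ≤ z.1) : ‖fderiv ℝ (mollify φ E) z (1, 0)‖ ≤ lInftyNorm (weakDeriv E) := by
  obtain ⟨-, hE0, hd, (hD : MemLInfty (weakDeriv E))⟩ := hE
  rw [fderiv_mollify hE0 hD (.weakDeriv hd) (by linarith [φ.rOut_pos])]
  simpa using (mollify φ (weakDeriv E) z).le_of_opNorm_le
    (norm_mollify_le (lInftyNorm_nonneg _) hD.ae_norm_le z) (1, 0)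

theorem IsSobolevField.norm_fderiv_mollify_space_le (hE : IsSobolevField 1 E) {z : SpaceTime}
    (hz : 0 ≤ z.1) (h : Plane) : ‖fderiv ℝ (mollify φ E) z (0, h)‖ ≤ Kx E * ‖h‖ := by
  obtain ⟨-, hE0, hd, (hD : MemLInfty (weakDeriv E))⟩ := hE
  rw [fderiv_mollify hE0 hD (.weakDeriv hd) (by linarith [φ.rOut_pos]), mollify_apply_apply hD]
  refine norm_mollify_le (mul_nonneg (Kx_nonneg E) (norm_nonneg h)) ?_ z
  filter_upwards [ae_norm_weakDeriv_space_le hD] with w hw using hw h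

theorem IsSobolevField.isLipField (hE : IsSobolevField 1 E) :
    IsLipField E (lInftyNorm E) (lInftyNorm (weakDeriv E)) (Kx E) := by
  let φ (n : ℕ) := bumpOfRadius (1 / (n + 1)) Nat.one_div_pos_of_nat
  have hlim {z : SpaceTime} (hz : 0 ≤ z.1) :
      Tendsto (fun n => mollify (φ n) E z) atTop (𝓝 (E z)) :=
    tendsto_mollify tendsto_one_div_add_atTop_nhds_zero_nat hE.2.1 hE.1 hz
  have hdiff (n : ℕ) : Differentiable ℝ (mollify (φ n) E) :=
    (contDiff_mollify hE.2.1).differentiable (by simp)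
  refine ⟨fun t x ht => ?_, fun s t x hs ht => ?_, fun t x y ht => ?_⟩
  · exact le_of_tendsto' (hlim ht).norm fun n =>
      norm_mollify_le (lInftyNorm_nonneg E) hE.2.1.ae_norm_le _
  · exact le_of_tendsto' ((hlim hs).sub (hlim ht)).norm fun n =>
      norm_sub_le_of_norm_fderiv_time_le (hdiff n) (convex_Ici 0)
        (fun r hr => hE.norm_fderiv_mollify_time_le hr) hs ht
  · exact le_of_tendsto' ((hlim ht).sub (hlim ht)).norm fun n =>
      norm_sub_le_of_norm_fderiv_space_le (hdiff n) (Kx_nonneg E)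
        (fun w h => hE.norm_fderiv_mollify_space_le ht h) x y

variable {M L K : ℝ}

theorem IsLipField.M_nonneg (hE : IsLipField E M L K) : 0 ≤ M :=
  (norm_nonneg _).trans (hE.bound 0 0 le_rfl)

theorem IsLipField.L_nonneg (hE : IsLipField E M L K) : 0 ≤ L := by
  simpa using (norm_nonneg _).trans (hE.lip_t 0 1 0 le_rfl zero_le_one)

theorem IsLipField.K_nonneg (hE : IsLipField E M L K) : 0 ≤ K := by
  obtain ⟨u, hu⟩ := exists_norm_eq Plane zero_le_one
  simpa [hu] using (norm_nonneg _).trans (hE.lip_x 0 u 0 le_rfl)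

theorem IsLipField.norm_sub_le (hE : IsLipField E M L K) {z w : SpaceTime} (hz : 0 ≤ z.1)
    (hw : 0 ≤ w.1) : ‖E z - E w‖ ≤ L * |z.1 - w.1| + K * ‖z.2 - w.2‖ :=
  (norm_sub_le_norm_sub_add_norm_sub _ (E (w.1, z.2)) _).trans
    (add_le_add (hE.lip_t _ _ _ hz hw) (hE.lip_x _ _ _ hw))

theorem IsLipField.continuousOn (hE : IsLipField E M L K) : ContinuousOn E (Ici 0 ×ˢ univ) := by
  refine (LipschitzOnWith.of_dist_le' (K := L + K) fun z hz w hw => ?_).continuousOn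
  have hL := hE.L_nonneg
  have hK := hE.K_nonneg
  rw [dist_eq_norm, dist_eq_norm, add_mul]
  refine (hE.norm_sub_le hz.1 hw.1).trans ?_
  gcongr
  · exact norm_fst_le (z - w)
  · exact norm_snd_le (z - w)

theorem IsLipField.norm_mollify_sub_le (hE : IsLipField E M L K) (hE0 : MemLInfty E)
    {z : SpaceTime} (hz : 0 ≤ z.1) : ‖mollify φ E z - E z‖ ≤ (L + K) * (3 * φ.rOut) := by
  have hL := hE.L_nonneg
  have hK := hE.K_nonneg
  have hr := φ.rOut_pos
  refine _root_.norm_mollify_sub_le hE0 hz (by positivity) fun w hw hwz => ?_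
  refine (hE.norm_sub_le hw.le hz).trans ?_
  rw [add_mul]
  gcongr
  · exact (norm_fst_le (w - z)).trans hwz.le
  · exact (norm_snd_le (w - z)).trans hwz.le

theorem IsSobolevField.norm_fderiv_fderiv_mollify_le (hE : IsSobolevField 2 E) {z : SpaceTime}
    (hz : 0 ≤ z.1) :
    ‖fderiv ℝ (fderiv ℝ (mollify φ E)) z‖ ≤ lInftyNorm (weakDeriv (weakDeriv E)) := by
  obtain ⟨-, hE0, hd, hD, hdd, (hDD : MemLInfty (weakDeriv (weakDeriv E)))⟩ := hE
  have hz : -φ.rOut < z.1 := by linarith [φ.rOut_pos]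
  have hfderiv : fderiv ℝ (mollify φ E) =ᶠ[𝓝 z] mollify φ (weakDeriv E) := by
    filter_upwards [(isOpen_lt continuous_const continuous_fst).mem_nhds hz] with w hw
    exact fderiv_mollify hE0 hD (.weakDeriv hd) hw
  rw [hfderiv.fderiv_eq, fderiv_mollify hD hDD (.weakDeriv hdd) hz]
  exact norm_mollify_le (lInftyNorm_nonneg _) hDD.ae_norm_le _

theorem IsSobolevField.exists_isSmoothApprox (hE : IsSobolevField 2 E) {δ : ℝ} (hδ : 0 < δ) :
    ∃ e, IsSmoothApprox E e (Kx E) (lInftyNorm (weakDeriv (weakDeriv E))) δ := by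
  have hE1 := hE.one_of_two
  obtain ⟨r, hr, hrδ⟩ := exists_pos_mul_lt hδ ((lInftyNorm (weakDeriv E) + Kx E) * 3)
  refine ⟨mollify (bumpOfRadius r hr) E, contDiff_mollify hE.2.1, fun z hz => ?_,
    fun z hz h => hE1.norm_fderiv_mollify_space_le hz h,
    fun z hz => hE.norm_fderiv_fderiv_mollify_le hz⟩
  rw [norm_sub_rev]
  refine (hE1.isLipField.norm_mollify_sub_le hE.2.1 hz).trans ?_
  rw [← mul_assoc]
  exact hrδ.le

end SobolevFields

section Rotation

theorem perp_add (v w : Plane) : perp (v + w) = perp v + perp w := by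
  ext i; fin_cases i <;> simp [perp]; ring

theorem perp_smul (c : ℝ) (v : Plane) : perp (c • v) = c • perp v := by
  ext i; fin_cases i <;> simp [perp]

/-- The rotation `perp` as a continuous linear map. -/
noncomputable def perpCLM : Plane →L[ℝ] Plane :=
  LinearMap.toContinuousLinearMap
    { toFun := perp, map_add' := perp_add, map_smul' := perp_smul }

theorem perp_sub (v w : Plane) : perp (v - w) = perp v - perp w := map_sub perpCLM v w

theorem perp_perp (v : Plane) : perp (perp v) = -v := by
  ext i; fin_cases i <;> simp [perp]

theorem norm_add_smul_perp_sq (c : ℝ) (v : Plane) :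
    ‖v + c • perp v‖ ^ 2 = (1 + c ^ 2) * ‖v‖ ^ 2 := by
  simp only [EuclideanSpace.norm_sq_eq, Fin.sum_univ_two, Real.norm_eq_abs, sq_abs]
  simp [perp]
  ring

theorem norm_perp (v : Plane) : ‖perp v‖ = ‖v‖ := by
  simp [EuclideanSpace.norm_eq, Fin.sum_univ_two, perp, add_comm]

theorem norm_smul_perp {c : ℝ} (hc : 0 ≤ c) (v : Plane) : ‖c • perp v‖ = c * ‖v‖ := by
  rw [norm_smul, norm_perp, Real.norm_of_nonneg hc]

theorem norm_le_norm_add_smul_perp (c : ℝ) (v : Plane) : ‖v‖ ≤ ‖v + c • perp v‖ := by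
  refine (sq_le_sq₀ (norm_nonneg _) (norm_nonneg _)).1 ?_
  rw [norm_add_smul_perp_sq]
  exact le_mul_of_one_le_left (sq_nonneg _) (le_add_of_nonneg_right (sq_nonneg c))

theorem norm_add_smul_perp_le (c : ℝ) (v : Plane) : ‖v + c • perp v‖ ≤ (1 + c ^ 2) * ‖v‖ := by
  refine (sq_le_sq₀ (norm_nonneg _) (by positivity)).1 ?_
  rw [norm_add_smul_perp_sq, mul_pow]
  gcongr
  exact le_self_pow₀ (le_add_of_nonneg_right (sq_nonneg c)) two_ne_zero

theorem add_smul_perp_eq_iff {c : ℝ} {v b : Plane} :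
    v + c • perp v = b ↔ v = (1 + c ^ 2)⁻¹ • (b - c • perp b) := by
  have hc : 1 + c ^ 2 ≠ 0 := by positivity
  rw [eq_inv_smul_iff₀ hc]
  constructor
  · rintro rfl
    rw [perp_add, perp_smul, perp_perp]
    module
  · intro h
    rw [← smul_right_inj hc, smul_add, smul_comm, ← perp_smul, h, perp_sub, perp_smul, perp_perp]
    module

end Rotation

section Scheme

variable {E : SpaceTime → Plane} {ε τ : ℝ} {x₀ v₀ : Plane} {y v : ℕ → Plane}

theorem step_v_iff (hε : 0 < ε) (hτ : 0 < τ) {v w F : Plane} :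
    τ⁻¹ • (w - v) = ε⁻¹ • F - (ε ^ 2)⁻¹ • perp w ↔
      w + (τ / ε ^ 2) • perp w = v + (τ / ε) • F := by
  rw [inv_smul_eq_iff₀ hτ.ne']
  constructor <;> intro h <;>
    linear_combination (norm := (match_scalars <;> field_simp <;> ring)) h

theorem step_y_iff (hτ : 0 < τ) {y w F : Plane} :
    τ⁻¹ • (w - y) = -perp F ↔ w = y - τ • perp F := by
  rw [inv_smul_eq_iff₀ hτ.ne', sub_eq_iff_eq_add, smul_neg, neg_add_eq_sub]

theorem IsScheme.v_succ (h : IsScheme E ε τ x₀ v₀ y v) (hε : 0 < ε) (hτ : 0 < τ) (n : ℕ) :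
    v (n + 1) + (τ / ε ^ 2) • perp (v (n + 1)) =
      v n + (τ / ε) • E (n * τ, y n + ε • perp (v n)) :=
  (step_v_iff hε hτ).1 (h.step_v n)

theorem IsScheme.y_succ (h : IsScheme E ε τ x₀ v₀ y v) (hτ : 0 < τ) (n : ℕ) :
    y (n + 1) = y n - τ • perp (E (n * τ, y n + ε • perp (v (n + 1)))) :=
  (step_y_iff hτ).1 (h.step_y n)

/-- The scheme solved for `(yⁿ, vⁿ)`: the velocity update inverts `1 + τ ε⁻² J`. -/
noncomputable def schemeIterate (E : SpaceTime → Plane) (ε τ : ℝ) (x₀ v₀ : Plane) :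
    ℕ → Plane × Plane
  | 0 => (x₀ - ε • perp v₀, v₀)
  | n + 1 =>
    let y := (schemeIterate E ε τ x₀ v₀ n).1
    let v := (schemeIterate E ε τ x₀ v₀ n).2
    let b := v + (τ / ε) • E (n * τ, y + ε • perp v)
    let w := (1 + (τ / ε ^ 2) ^ 2)⁻¹ • (b - (τ / ε ^ 2) • perp b)
    (y - τ • perp (E (n * τ, y + ε • perp w)), w)

theorem isScheme_schemeIterate (E : SpaceTime → Plane) (hε : 0 < ε) (hτ : 0 < τ)
    (x₀ v₀ : Plane) :
    IsScheme E ε τ x₀ v₀ (fun n => (schemeIterate E ε τ x₀ v₀ n).1)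
      (fun n => (schemeIterate E ε τ x₀ v₀ n).2) where
  init_y := rfl
  init_v := rfl
  step_v _ := (step_v_iff hε hτ).2 (add_smul_perp_eq_iff.2 rfl)
  step_y _ := (step_y_iff hτ).2 rfl

theorem IsScheme.eq_schemeIterate (h : IsScheme E ε τ x₀ v₀ y v) (hε : 0 < ε) (hτ : 0 < τ)
    (n : ℕ) : (y n, v n) = schemeIterate E ε τ x₀ v₀ n := by
  induction n with
  | zero => exact Prod.ext h.init_y h.init_v
  | succ n ih =>
    have hv := add_smul_perp_eq_iff.1 (h.v_succ hε hτ n)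
    rw [schemeIterate, ← ih, ← hv, ← h.y_succ hτ n]

theorem existsUnique_isScheme (E : SpaceTime → Plane) (hε : 0 < ε) (hτ : 0 < τ)
    (x₀ v₀ : Plane) :
    ∃! p : (ℕ → Plane) × (ℕ → Plane), IsScheme E ε τ x₀ v₀ p.1 p.2 := by
  refine ⟨(_, _), isScheme_schemeIterate E hε hτ x₀ v₀, fun p hp => ?_⟩
  have heq := hp.eq_schemeIterate hε hτ
  exact Prod.ext (funext fun n => congrArg Prod.fst (heq n))
    (funext fun n => congrArg Prod.snd (heq n))

end Scheme

section VelocityBounds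

theorem le_mul_exp_of_le_exp_mul_add {s : ℕ → ℝ} {q τ D : ℝ} {n : ℕ}
    (h : ∀ k < n, s (k + 1) ≤
      Real.exp (q * τ) * s k + τ * D * Real.exp (q * ((k + 1 : ℕ) * τ))) :
    s n ≤ (s 0 + n * τ * D) * Real.exp (q * (n * τ)) := by
  induction n with
  | zero => simp
  | succ n ih =>
    have hexp : Real.exp (q * ((n + 1 : ℕ) * τ)) = Real.exp (q * τ) * Real.exp (q * (n * τ)) := by
      rw [← Real.exp_add]; push_cast; ring_nf
    calc s (n + 1)
        ≤ Real.exp (q * τ) * s n + τ * D * Real.exp (q * ((n + 1 : ℕ) * τ)) := h n n.lt_succ_self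
      _ ≤ Real.exp (q * τ) * ((s 0 + n * τ * D) * Real.exp (q * (n * τ))) +
          τ * D * Real.exp (q * ((n + 1 : ℕ) * τ)) := by
        gcongr
        exact ih fun k hk => h k (hk.trans n.lt_succ_self)
      _ = _ := by rw [hexp]; push_cast; ring

theorem gronwallBound_le_mul_exp {δ K ε t : ℝ} (hK : 0 ≤ K) (hε : 0 ≤ ε) :
    gronwallBound δ K ε t ≤ (δ + t * ε) * Real.exp (K * t) := by
  rcases hK.eq_or_lt with rfl | hK
  · simp [gronwallBound_K0, mul_comm]
  · have hexp : Real.exp (K * t) - 1 ≤ K * t * Real.exp (K * t) := by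
      have := mul_le_mul_of_nonneg_right (Real.add_one_le_exp (-(K * t))) (Real.exp_pos (K * t)).le
      rw [← Real.exp_add, neg_add_cancel, Real.exp_zero] at this
      linarith
    calc gronwallBound δ K ε t
        = δ * Real.exp (K * t) + ε / K * (Real.exp (K * t) - 1) :=
          congrFun (gronwallBound_of_K_ne_0 hK.ne') t
      _ ≤ δ * Real.exp (K * t) + ε / K * (K * t * Real.exp (K * t)) := by gcongr
      _ = _ := by field_simp

/-- The factor in front of `exp (K t)` in the bounds on the velocity at time `t`, uniform as
`ε → 0`; `b` stands for the norm of the initial velocity. -/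
noncomputable def velocityAmplitude (M L K ε b t : ℝ) : ℝ :=
  b + ε * (2 * M + t * (L + 3 * K * M))

/-- The velocity relative to the drift velocity `-ε E^⊥`, in which the electric force is balanced
by the magnetic one. -/
noncomputable def relVelocity (E : SpaceTime → Plane) (ε t : ℝ) (x v : Plane) : Plane :=
  v + ε • perp (E (t, x))

variable {E : SpaceTime → Plane} {M L K ε τ : ℝ} {x₀ v₀ : Plane}

theorem IsLipField.norm_relVelocity_le (hE : IsLipField E M L K) (hε : 0 ≤ ε) {t : ℝ} (ht : 0 ≤ t)
    (x v : Plane) : ‖relVelocity E ε t x v‖ ≤ ‖v‖ + ε * M := by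
  refine (norm_add_le _ _).trans ?_
  rw [norm_smul_perp hε]
  gcongr
  exact hE.bound t x ht

theorem IsLipField.norm_le_norm_relVelocity_add (hE : IsLipField E M L K) (hε : 0 ≤ ε) {t : ℝ}
    (ht : 0 ≤ t) (x v : Plane) : ‖v‖ ≤ ‖relVelocity E ε t x v‖ + ε * M := by
  refine (norm_le_add_norm_add _ (ε • perp (E (t, x)))).trans ?_
  rw [norm_smul_perp hε, relVelocity]
  gcongr
  exact hE.bound t x ht

theorem le_velocityAmplitude_mul_exp {u v b t : ℝ} (hM : 0 ≤ M) (hK : 0 ≤ K) (hε : 0 ≤ ε)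
    (ht : 0 ≤ t) (hv : v ≤ u + ε * M)
    (hu : u ≤ (b + ε * M + t * (ε * (L + 3 * K * M))) * Real.exp (K * t)) :
    v ≤ velocityAmplitude M L K ε b t * Real.exp (K * t) := by
  have hexp : ε * M ≤ ε * M * Real.exp (K * t) :=
    le_mul_of_one_le_right (by positivity) (Real.one_le_exp (by positivity))
  rw [velocityAmplitude]
  linarith

namespace IsScheme

variable {y v : ℕ → Plane}

theorem norm_relVelocity_succ_le (h : IsScheme E ε τ x₀ v₀ y v) (hε : 0 < ε) (hτ : 0 < τ)
    (n : ℕ) :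
    ‖relVelocity E ε (n * τ) (y n + ε • perp (v n)) (v (n + 1))‖ ≤
      ‖relVelocity E ε (n * τ) (y n + ε • perp (v n)) (v n)‖ := by
  refine (norm_le_norm_add_smul_perp (τ / ε ^ 2) _).trans_eq (congrArg _ ?_)
  rw [relVelocity, relVelocity, perp_add, perp_smul, perp_perp, smul_add, add_add_add_comm,
    h.v_succ hε hτ]
  match_scalars <;> field_simp
  ring

theorem norm_x_succ_sub_le (h : IsScheme E ε τ x₀ v₀ y v) (hE : IsLipField E M L K) (hε : 0 < ε)
    (hτ : 0 < τ) (n : ℕ) :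
    ‖(y (n + 1) + ε • perp (v (n + 1))) - (y n + ε • perp (v n))‖ ≤
      τ * (2 * M + ‖v (n + 1)‖ / ε) := by
  have hbound (z : Plane) : ‖E (n * τ, z)‖ ≤ M := hE.bound _ z (by positivity)
  have hperp := congrArg perp (h.v_succ hε hτ n)
  simp only [perp_add, perp_smul, perp_perp] at hperp
  have hx : (y (n + 1) + ε • perp (v (n + 1))) - (y n + ε • perp (v n)) =
      τ • perp (E (n * τ, y n + ε • perp (v n)) - E (n * τ, y n + ε • perp (v (n + 1)))) +
        (τ / ε) • v (n + 1) := by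
    rw [h.y_succ hτ n, perp_sub]
    linear_combination (norm := (match_scalars <;> field_simp <;> ring)) ε • hperp
  rw [hx, mul_add, mul_div_left_comm, mul_comm ‖v (n + 1)‖]
  refine (norm_add_le _ _).trans (add_le_add ?_ ?_)
  · rw [norm_smul_perp hτ.le]
    gcongr
    exact (norm_sub_le _ _).trans ((add_le_add (hbound _) (hbound _)).trans_eq (two_mul M).symm)
  · rw [norm_smul, Real.norm_of_nonneg (by positivity)]

theorem norm_relVelocity_step_le (h : IsScheme E ε τ x₀ v₀ y v) (hE : IsLipField E M L K)
    (hε : 0 < ε) (hτ : 0 < τ) (n : ℕ) :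
    ‖relVelocity E ε ((n + 1 : ℕ) * τ) (y (n + 1) + ε • perp (v (n + 1))) (v (n + 1))‖ ≤
      (1 + K * τ) * ‖relVelocity E ε (n * τ) (y n + ε • perp (v n)) (v n)‖ +
        τ * (ε * (L + 3 * K * M)) := by
  have hK := hE.K_nonneg
  set X : ℕ → Plane := fun n => y n + ε • perp (v n)
  set u := relVelocity E ε (n * τ) (X n) (v n)
  have hw : ‖relVelocity E ε (n * τ) (X n) (v (n + 1))‖ ≤ ‖u‖ := h.norm_relVelocity_succ_le hε hτ n
  have hv : ‖v (n + 1)‖ ≤ ‖u‖ + ε * M :=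
    (hE.norm_le_norm_relVelocity_add hε.le (by positivity) (X n) _).trans
      (add_le_add_left hw _)
  have hEsub : ‖E ((n + 1 : ℕ) * τ, X (n + 1)) - E (n * τ, X n)‖ ≤
      L * τ + K * (τ * (2 * M + ‖v (n + 1)‖ / ε)) := by
    refine (hE.norm_sub_le (by positivity) (by positivity)).trans (add_le_add (le_of_eq ?_) ?_)
    · rw [show ((n + 1 : ℕ) * τ - n * τ : ℝ) = τ by push_cast; ring, abs_of_pos hτ]
    · exact mul_le_mul_of_nonneg_left (h.norm_x_succ_sub_le hE hε hτ n) hK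
  have hsplit : relVelocity E ε ((n + 1 : ℕ) * τ) (X (n + 1)) (v (n + 1)) =
      relVelocity E ε (n * τ) (X n) (v (n + 1)) +
        ε • perp (E ((n + 1 : ℕ) * τ, X (n + 1)) - E (n * τ, X n)) := by
    rw [relVelocity, relVelocity, perp_sub]
    module
  calc ‖relVelocity E ε ((n + 1 : ℕ) * τ) (X (n + 1)) (v (n + 1))‖
      ≤ ‖u‖ + ε * (L * τ + K * (τ * (2 * M + ‖v (n + 1)‖ / ε))) := by
        rw [hsplit]
        refine (norm_add_le _ _).trans (add_le_add hw ?_)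
        rw [norm_smul_perp hε.le]
        gcongr
    _ = ‖u‖ + ε * τ * (L + 2 * K * M) + K * τ * ‖v (n + 1)‖ := by field_simp; ring
    _ ≤ ‖u‖ + ε * τ * (L + 2 * K * M) + K * τ * (‖u‖ + ε * M) := by gcongr
    _ = _ := by ring

theorem norm_v_le (h : IsScheme E ε τ x₀ v₀ y v) (hE : IsLipField E M L K) (hε : 0 < ε)
    (hτ : 0 < τ) (n : ℕ) :
    ‖v n‖ ≤ velocityAmplitude M L K ε ‖v₀‖ (n * τ) * Real.exp (K * (n * τ)) := by
  have hM := hE.M_nonneg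
  have hL := hE.L_nonneg
  have hK := hE.K_nonneg
  refine le_velocityAmplitude_mul_exp hM hK hε.le (by positivity)
    (hE.norm_le_norm_relVelocity_add hε.le (by positivity) _ (v n))
    ((le_mul_exp_of_le_exp_mul_add
      (s := fun k => ‖relVelocity E ε (k * τ) (y k + ε • perp (v k)) (v k)‖) (q := K) (τ := τ)
      (D := ε * (L + 3 * K * M)) fun k _ =>
        (h.norm_relVelocity_step_le hE hε hτ k).trans (add_le_add ?_ ?_)).trans ?_)
  · gcongr
    linarith [Real.add_one_le_exp (K * τ)]
  · exact le_mul_of_one_le_right (by positivity) (Real.one_le_exp (by positivity))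
  · gcongr
    exact h.init_v ▸ hE.norm_relVelocity_le hε.le (by positivity) _ _

end IsScheme

end VelocityBounds

namespace IsCharacteristic

open Filter Topology

variable {E : SpaceTime → Plane} {M L K ε : ℝ} {x₀ v₀ : Plane} {x v : ℝ → Plane}

theorem hasDerivWithinAt_x_Ioi (h : IsCharacteristic E ε x₀ v₀ x v) {s : ℝ} (hs : 0 ≤ s) :
    HasDerivWithinAt x (ε⁻¹ • v s) (Ioi s) s :=
  (h.deriv_x s hs).mono (Ioi_subset_Ici hs)

theorem hasDerivWithinAt_v_Ioi (h : IsCharacteristic E ε x₀ v₀ x v) (hε : 0 < ε) {s : ℝ}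
    (hs : 0 ≤ s) :
    HasDerivWithinAt v (-((ε ^ 2)⁻¹ • perp (relVelocity E ε s (x s) (v s)))) (Ioi s) s := by
  refine ((h.deriv_v s hs).mono (Ioi_subset_Ici hs)).congr_deriv ?_
  rw [relVelocity, perp_add, perp_smul, perp_perp]
  match_scalars <;> field_simp

/-- With the field frozen at time `s`, the relative velocity only rotates, and a step of explicit
Euler stretches a rotation by a factor `1 + O((z - s)²)`. -/
theorem norm_relVelocity_le_of_lt (hE : IsLipField E M L K) (hε : 0 < ε) {s z : ℝ} (hs : 0 ≤ s)
    (hz : s < z) (x v : ℝ → Plane) :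
    ‖relVelocity E ε z (x z) (v z)‖ - ‖relVelocity E ε s (x s) (v s)‖ ≤
      (z - s) * ((z - s) / ε ^ 4 * ‖relVelocity E ε s (x s) (v s)‖ +
        ε * (L + K * ‖slope x s z‖) +
        ‖slope v s z - -((ε ^ 2)⁻¹ • perp (relVelocity E ε s (x s) (v s)))‖) := by
  have hh : 0 < z - s := sub_pos.2 hz
  set u := relVelocity E ε s (x s) (v s) with hu
  set r := slope v s z - -((ε ^ 2)⁻¹ • perp u)
  have hslope (f : ℝ → Plane) : (z - s) • slope f s z = f z - f s := sub_smul_slope f s z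
  have hx : ‖x z - x s‖ = (z - s) * ‖slope x s z‖ := by
    rw [← hslope x, norm_smul, Real.norm_of_nonneg hh.le]
  have hEsub : ‖E (z, x z) - E (s, x s)‖ ≤ (z - s) * (L + K * ‖slope x s z‖) := by
    refine (hE.norm_sub_le (hs.trans hz.le) hs).trans_eq ?_
    rw [hx, abs_of_pos hh]
    ring
  have hsplit : relVelocity E ε z (x z) (v z) = (u + (-((z - s) / ε ^ 2)) • perp u) +
      ε • perp (E (z, x z) - E (s, x s)) + (z - s) • r := by
    have hdiff : relVelocity E ε z (x z) (v z) =
        u + ε • perp (E (z, x z) - E (s, x s)) + (v z - v s) := by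
      rw [hu, relVelocity, relVelocity, perp_sub]
      module
    rw [hdiff, ← hslope v]
    module
  rw [hsplit, sub_le_iff_le_add]
  calc _ ≤ (1 + (-((z - s) / ε ^ 2)) ^ 2) * ‖u‖ + ε * ((z - s) * (L + K * ‖slope x s z‖)) +
        (z - s) * ‖r‖ := by
        refine (norm_add₃_le).trans (add_le_add (add_le_add (norm_add_smul_perp_le _ _) ?_) ?_)
        · rw [norm_smul_perp hε.le]
          gcongr
        · rw [norm_smul, Real.norm_of_nonneg hh.le]
    _ = _ := by ring

theorem eventually_slope_norm_relVelocity_lt (h : IsCharacteristic E ε x₀ v₀ x v)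
    (hE : IsLipField E M L K) (hε : 0 < ε) {s r : ℝ} (hs : 0 ≤ s)
    (hr : K * ‖relVelocity E ε s (x s) (v s)‖ + ε * (L + K * M) < r) :
    ∀ᶠ z in 𝓝[>] s, (z - s)⁻¹ *
      (‖relVelocity E ε z (x z) (v z)‖ - ‖relVelocity E ε s (x s) (v s)‖) < r := by
  set u := relVelocity E ε s (x s) (v s)
  have hslope {f : ℝ → Plane} {f' : Plane} (hf : HasDerivWithinAt f f' (Ioi s) s) :
      Tendsto (slope f s) (𝓝[>] s) (𝓝 f') :=
    (hasDerivWithinAt_iff_tendsto_slope' self_notMem_Ioi).1 hf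
  have hz : Tendsto (fun z => z - s) (𝓝[>] s) (𝓝 0) := by
    have : Tendsto (fun z => z - s) (𝓝 s) (𝓝 (s - s)) := tendsto_id.sub_const s
    exact (sub_self s ▸ this).mono_left nhdsWithin_le_nhds
  have hlim := (((hz.div_const (ε ^ 4)).mul_const ‖u‖).add
    ((((hslope (h.hasDerivWithinAt_x_Ioi hs)).norm.const_mul K).const_add L).const_mul ε)).add
    ((hslope (h.hasDerivWithinAt_v_Ioi hε hs)).sub_const
      (-((ε ^ 2)⁻¹ • perp u))).norm
  have hlt : 0 / ε ^ 4 * ‖u‖ + ε * (L + K * ‖ε⁻¹ • v s‖) +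
      ‖-((ε ^ 2)⁻¹ • perp u) - -((ε ^ 2)⁻¹ • perp u)‖ < r := by
    have hv := mul_le_mul_of_nonneg_left (hE.norm_le_norm_relVelocity_add hε.le hs (x s) (v s))
      hE.K_nonneg
    rw [sub_self, norm_zero, zero_div, zero_mul, zero_add, add_zero, norm_smul,
      Real.norm_of_nonneg (inv_pos.2 hε).le]
    calc ε * (L + K * (ε⁻¹ * ‖v s‖)) = ε * L + K * ‖v s‖ := by field_simp
      _ < r := by linarith
  filter_upwards [hlim.eventually_lt_const hlt, self_mem_nhdsWithin] with z hzr hsz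
  exact ((inv_mul_le_iff₀ (sub_pos.2 hsz)).2
    (norm_relVelocity_le_of_lt hE hε hs hsz x v)).trans_lt hzr

theorem continuousOn_relVelocity (h : IsCharacteristic E ε x₀ v₀ x v) (hE : IsLipField E M L K) :
    ContinuousOn (fun s => relVelocity E ε s (x s) (v s)) (Ici 0) := by
  have hx : ContinuousOn x (Ici 0) := fun s hs => (h.deriv_x s hs).continuousWithinAt
  have hv : ContinuousOn v (Ici 0) := fun s hs => (h.deriv_v s hs).continuousWithinAt
  have hEx := hE.continuousOn.comp (continuousOn_id.prodMk hx) fun s hs => ⟨hs, mem_univ _⟩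
  exact hv.add ((perpCLM.continuous.comp_continuousOn hEx).const_smul ε)

theorem norm_v_le (h : IsCharacteristic E ε x₀ v₀ x v) (hE : IsLipField E M L K) (hε : 0 < ε)
    {t : ℝ} (ht : 0 ≤ t) :
    ‖v t‖ ≤ velocityAmplitude M L K ε ‖v₀‖ t * Real.exp (K * t) := by
  have hM := hE.M_nonneg
  have hL := hE.L_nonneg
  have hK := hE.K_nonneg
  have hinit : ‖relVelocity E ε 0 (x 0) (v 0)‖ ≤ ‖v₀‖ + ε * M :=
    h.init_v ▸ hE.norm_relVelocity_le hε.le le_rfl (x 0) (v 0)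
  have hgronwall := le_gronwallBound_of_liminf_deriv_right_le (b := t)
    ((h.continuousOn_relVelocity hE).norm.mono Icc_subset_Ici_self)
    (fun s hs r hr => (h.eventually_slope_norm_relVelocity_lt hE hε hs.1 hr).frequently)
    hinit (fun _ _ => le_rfl) t ⟨ht, le_rfl⟩
  rw [sub_zero] at hgronwall
  refine le_velocityAmplitude_mul_exp hM hK hε.le ht
    (hE.norm_le_norm_relVelocity_add hε.le ht (x t) (v t))
    (hgronwall.trans ((gronwallBound_le_mul_exp hK (by positivity)).trans ?_))
  gcongr
  linarith [mul_nonneg hK hM]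

end IsCharacteristic

section Consistency

theorem norm_sub_sub_smul_le_of_norm_deriv_sub_le {V : Type*} [NormedAddCommGroup V]
    [NormedSpace ℝ V] {f f' : ℝ → V}
    (hf : ∀ s, 0 ≤ s → HasDerivWithinAt f (f' s) (Ici 0) s) {t τ B : ℝ} {c : V} (ht : 0 ≤ t)
    (hτ : 0 ≤ τ) (hB : ∀ s ∈ Icc t (t + τ), ‖f' s - c‖ ≤ B) :
    ‖f (t + τ) - f t - τ • c‖ ≤ τ * B := by
  have hderiv : ∀ s ∈ Icc t (t + τ),
      HasDerivWithinAt (fun s => f s - s • c) (f' s - c) (Icc t (t + τ)) s := fun s hs =>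
    (((hf s (ht.trans hs.1)).mono fun r hr => ht.trans hr.1).sub
      ((hasDerivWithinAt_id s _).smul_const c)).congr_deriv (by rw [one_smul])
  have hmvt := (convex_Icc t (t + τ)).norm_image_sub_le_of_norm_hasDerivWithin_le hderiv hB
    (left_mem_Icc.2 (le_add_of_nonneg_right hτ)) (right_mem_Icc.2 (le_add_of_nonneg_right hτ))
  rw [add_sub_cancel_left, Real.norm_of_nonneg hτ, mul_comm B] at hmvt
  refine le_of_eq_of_le (congrArg norm ?_) hmvt
  module

theorem norm_sub_le_of_norm_deriv_le {V : Type*} [NormedAddCommGroup V] [NormedSpace ℝ V]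
    {f f' : ℝ → V} (hf : ∀ s, 0 ≤ s → HasDerivWithinAt f (f' s) (Ici 0) s) {t τ B r s : ℝ}
    (ht : 0 ≤ t) (hB : ∀ s ∈ Icc t (t + τ), ‖f' s‖ ≤ B) (hr : r ∈ Icc t (t + τ))
    (hs : s ∈ Icc t (t + τ)) : ‖f r - f s‖ ≤ B * τ := by
  refine ((convex_Icc t (t + τ)).norm_image_sub_le_of_norm_hasDerivWithin_le
    (fun s hs => (hf s (ht.trans hs.1)).mono fun r hr => ht.trans hr.1) hB hs hr).trans ?_
  refine mul_le_mul_of_nonneg_left ?_ ((norm_nonneg _).trans (hB s hs))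
  rw [Real.norm_eq_abs, abs_le]
  constructor <;> linarith [hr.1, hr.2, hs.1, hs.2]

/-- The guiding center `y = x - ε v^⊥` of a characteristic. -/
noncomputable def guidingCenter (ε : ℝ) (x v : ℝ → Plane) (t : ℝ) : Plane := x t - ε • perp (v t)

theorem guidingCenter_add (ε : ℝ) (x v : ℝ → Plane) (t : ℝ) :
    guidingCenter ε x v t + ε • perp (v t) = x t := sub_add_cancel _ _

variable {E : SpaceTime → Plane} {M L K ε τ t W : ℝ} {x₀ v₀ : Plane} {x v : ℝ → Plane}

theorem IsLipField.norm_sub_le_of_mem (hE : IsLipField E M L K) {s : ℝ} (ht : 0 ≤ t)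
    (hs : s ∈ Icc t (t + τ)) (z w : Plane) : ‖E (s, z) - E (t, w)‖ ≤ L * τ + K * ‖z - w‖ := by
  have hL := hE.L_nonneg
  refine (hE.norm_sub_le (ht.trans hs.1) ht).trans ?_
  dsimp only
  gcongr
  rw [abs_le]
  constructor <;> linarith [hs.1, hs.2]

namespace IsCharacteristic

theorem hasDerivWithinAt_guidingCenter (h : IsCharacteristic E ε x₀ v₀ x v)
    (hε : 0 < ε) (s : ℝ) (hs : 0 ≤ s) :
    HasDerivWithinAt (guidingCenter ε x v) (-perp (E (s, x s))) (Ici 0) s := by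
  refine ((h.deriv_x s hs).sub ((perpCLM.hasFDerivAt.comp_hasDerivWithinAt s
    (h.deriv_v s hs)).const_smul ε)).congr_deriv ?_
  change _ - ε • perp _ = _
  simp only [perp_smul, perp_sub, perp_perp]
  match_scalars <;> field_simp
  ring

theorem norm_guidingCenter_sub_le (h : IsCharacteristic E ε x₀ v₀ x v) (hE : IsLipField E M L K)
    (hε : 0 < ε) (ht : 0 ≤ t) {r s : ℝ} (hr : r ∈ Icc t (t + τ)) (hs : s ∈ Icc t (t + τ)) :
    ‖guidingCenter ε x v r - guidingCenter ε x v s‖ ≤ M * τ :=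
  norm_sub_le_of_norm_deriv_le (h.hasDerivWithinAt_guidingCenter hε) ht
    (fun s hs => by rw [norm_neg, norm_perp]; exact hE.bound _ _ (ht.trans hs.1)) hr hs

theorem norm_x_sub_le (h : IsCharacteristic E ε x₀ v₀ x v) (hε : 0 < ε) (ht : 0 ≤ t)
    (hW : ∀ s ∈ Icc t (t + τ), ‖v s‖ ≤ W) {r s : ℝ} (hr : r ∈ Icc t (t + τ))
    (hs : s ∈ Icc t (t + τ)) : ‖x r - x s‖ ≤ ε⁻¹ * W * τ := by
  refine norm_sub_le_of_norm_deriv_le h.deriv_x ht (fun s hs => ?_) hr hs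
  rw [norm_smul, Real.norm_of_nonneg (by positivity)]
  gcongr
  exact hW s hs

theorem norm_v_sub_le (h : IsCharacteristic E ε x₀ v₀ x v) (hE : IsLipField E M L K)
    (hε : 0 < ε) (ht : 0 ≤ t) (hW : ∀ s ∈ Icc t (t + τ), ‖v s‖ ≤ W) {r s : ℝ}
    (hr : r ∈ Icc t (t + τ)) (hs : s ∈ Icc t (t + τ)) :
    ‖v r - v s‖ ≤ ε⁻¹ * (M + ε⁻¹ * W) * τ := by
  refine norm_sub_le_of_norm_deriv_le h.deriv_v ht (fun s hs => ?_) hr hs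
  rw [norm_smul, Real.norm_of_nonneg (by positivity)]
  gcongr
  refine (norm_sub_le _ _).trans ?_
  rw [norm_smul_perp (by positivity)]
  gcongr
  · exact hE.bound _ _ (ht.trans hs.1)
  · exact hW s hs

theorem norm_v_consistency_le (h : IsCharacteristic E ε x₀ v₀ x v) (hE : IsLipField E M L K)
    (hε : 0 < ε) (hτ : 0 ≤ τ) (ht : 0 ≤ t) (hW : ∀ s ∈ Icc t (t + τ), ‖v s‖ ≤ W) :
    ‖v (t + τ) + (τ / ε ^ 2) • perp (v (t + τ)) - (v t + (τ / ε) • E (t, x t))‖ ≤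
      τ * (τ * (L / ε + K * W / ε ^ 2 + M / ε ^ 3 + W / ε ^ 4)) := by
  have hK := hE.K_nonneg
  have hdrift (s : ℝ) (hs : s ∈ Icc t (t + τ)) :
      ‖ε⁻¹ • (E (s, x s) - ε⁻¹ • perp (v s)) - ε⁻¹ • (E (t, x t) - ε⁻¹ • perp (v (t + τ)))‖ ≤
        τ * (L / ε + K * W / ε ^ 2 + M / ε ^ 3 + W / ε ^ 4) := by
    have hsplit : ε⁻¹ • (E (s, x s) - ε⁻¹ • perp (v s)) -
        ε⁻¹ • (E (t, x t) - ε⁻¹ • perp (v (t + τ))) =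
        ε⁻¹ • (E (s, x s) - E (t, x t)) - ε⁻¹ • ε⁻¹ • perp (v s - v (t + τ)) := by
      rw [perp_sub]; module
    calc _ ≤ ε⁻¹ * (L * τ + K * (ε⁻¹ * W * τ)) +
          ε⁻¹ * (ε⁻¹ * (ε⁻¹ * (M + ε⁻¹ * W) * τ)) := by
          rw [hsplit]
          refine (norm_sub_le _ _).trans ?_
          rw [norm_smul, norm_smul, norm_smul_perp (by positivity),
            Real.norm_of_nonneg (by positivity)]
          gcongr
          · refine (hE.norm_sub_le_of_mem ht hs _ _).trans ?_
            gcongr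
            exact h.norm_x_sub_le hε ht hW hs (left_mem_Icc.2 (le_add_of_nonneg_right hτ))
          · exact h.norm_v_sub_le hE hε ht hW hs (right_mem_Icc.2 (le_add_of_nonneg_right hτ))
      _ = _ := by field_simp; ring
  refine le_of_eq_of_le (congrArg norm ?_)
    (norm_sub_sub_smul_le_of_norm_deriv_sub_le h.deriv_v ht hτ hdrift)
  match_scalars <;> field_simp

theorem norm_guidingCenter_step_le (h : IsCharacteristic E ε x₀ v₀ x v) (hε : 0 < ε)
    (hτ : 0 ≤ τ) (ht : 0 ≤ t) {c : Plane} {B : ℝ}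
    (hB : ∀ s ∈ Icc t (t + τ), ‖E (s, x s) - c‖ ≤ B) :
    ‖guidingCenter ε x v (t + τ) - (guidingCenter ε x v t - τ • perp c)‖ ≤ τ * B := by
  refine le_of_eq_of_le (congrArg norm ?_) (norm_sub_sub_smul_le_of_norm_deriv_sub_le
    (h.hasDerivWithinAt_guidingCenter hε) ht hτ (c := -perp c) fun s hs => ?_)
  · module
  · rw [← neg_sub', norm_neg, ← perp_sub, norm_perp]
    exact hB s hs

theorem norm_guidingCenter_consistency_le (h : IsCharacteristic E ε x₀ v₀ x v)
    (hE : IsLipField E M L K) (hε : 0 < ε) (hτ : 0 ≤ τ) (ht : 0 ≤ t)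
    (hW : ∀ s ∈ Icc t (t + τ), ‖v s‖ ≤ W) :
    ‖guidingCenter ε x v (t + τ) - (guidingCenter ε x v t -
        τ • perp (E (t, guidingCenter ε x v t + ε • perp (v (t + τ)))))‖ ≤
      τ * (τ * (L + 2 * K * M + K * W / ε)) := by
  have hK := hE.K_nonneg
  refine h.norm_guidingCenter_step_le hε hτ ht fun s hs => ?_
  have hx : ‖x s - (guidingCenter ε x v t + ε • perp (v (t + τ)))‖ ≤
      M * τ + ε * (ε⁻¹ * (M + ε⁻¹ * W) * τ) := by
    have hsplit : x s - (guidingCenter ε x v t + ε • perp (v (t + τ))) =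
        guidingCenter ε x v s - guidingCenter ε x v t + ε • perp (v s - v (t + τ)) := by
      rw [← guidingCenter_add ε x v s, perp_sub]; module
    rw [hsplit]
    refine (norm_add_le _ _).trans ?_
    rw [norm_smul_perp hε.le]
    gcongr
    · exact h.norm_guidingCenter_sub_le hE hε ht hs (left_mem_Icc.2 (le_add_of_nonneg_right hτ))
    · exact h.norm_v_sub_le hE hε ht hW hs (right_mem_Icc.2 (le_add_of_nonneg_right hτ))
  calc _ ≤ L * τ + K * (M * τ + ε * (ε⁻¹ * (M + ε⁻¹ * W) * τ)) :=
        (hE.norm_sub_le_of_mem ht hs _ _).trans (by gcongr)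
    _ = _ := by field_simp; ring

theorem norm_guidingCenter_limit_consistency_le (h : IsCharacteristic E ε x₀ v₀ x v)
    (hE : IsLipField E M L K) (hε : 0 < ε) (hτ : 0 ≤ τ) (ht : 0 ≤ t)
    (hW : ∀ s ∈ Icc t (t + τ), ‖v s‖ ≤ W) :
    ‖guidingCenter ε x v (t + τ) - (guidingCenter ε x v t -
        τ • perp (E (t, guidingCenter ε x v t)))‖ ≤ τ * (τ * (L + K * M) + K * ε * W) := by
  have hK := hE.K_nonneg
  refine h.norm_guidingCenter_step_le hε hτ ht fun s hs => ?_
  have hx : ‖x s - guidingCenter ε x v t‖ ≤ M * τ + ε * W := by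
    rw [← guidingCenter_add ε x v s, add_sub_right_comm]
    refine (norm_add_le _ _).trans ?_
    rw [norm_smul_perp hε.le]
    gcongr
    · exact h.norm_guidingCenter_sub_le hE hε ht hs (left_mem_Icc.2 (le_add_of_nonneg_right hτ))
    · exact hW s hs
  calc _ ≤ L * τ + K * (M * τ + ε * W) := (hE.norm_sub_le_of_mem ht hs _ _).trans (by gcongr)
    _ = _ := by ring

end IsCharacteristic

end Consistency

section FirstOrderEstimates

variable {E : SpaceTime → Plane} {M L K ε τ W : ℝ} {x₀ v₀ : Plane} {x v : ℝ → Plane}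
  {yd vd : ℕ → Plane} {k n : ℕ}

theorem velocityAmplitude_nonneg {b t : ℝ} (hM : 0 ≤ M) (hL : 0 ≤ L) (hK : 0 ≤ K) (hε : 0 ≤ ε)
    (hb : 0 ≤ b) (ht : 0 ≤ t) : 0 ≤ velocityAmplitude M L K ε b t := by
  unfold velocityAmplitude
  positivity

theorem velocityAmplitude_mul_exp_le {b s t T : ℝ} (hM : 0 ≤ M) (hL : 0 ≤ L) (hK : 0 ≤ K)
    (hε : 0 ≤ ε) (hb : 0 ≤ b) (hs : 0 ≤ s) (hst : s ≤ t) (htT : t ≤ T) :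
    velocityAmplitude M L K ε b s * Real.exp (K * s) ≤
      velocityAmplitude M L K ε b T * Real.exp (K * t) := by
  have hT : 0 ≤ T := hs.trans (hst.trans htT)
  refine mul_le_mul ?_ (by gcongr) (Real.exp_pos _).le
    (velocityAmplitude_nonneg hM hL hK hε hb hT)
  unfold velocityAmplitude
  gcongr
  exact hst.trans htT

theorem IsScheme.norm_v_le_of_le (hd : IsScheme E ε τ x₀ v₀ yd vd) (hE : IsLipField E M L K)
    (hε : 0 < ε) (hτ : 0 < τ) (hkn : k ≤ n) :
    ‖vd k‖ ≤ velocityAmplitude M L K ε ‖v₀‖ (n * τ) * Real.exp (K * (k * τ)) :=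
  (hd.norm_v_le hE hε hτ k).trans (velocityAmplitude_mul_exp_le hE.M_nonneg hE.L_nonneg
    hE.K_nonneg hε.le (norm_nonneg _) (by positivity) le_rfl (by gcongr))

theorem IsCharacteristic.norm_v_le_of_le (h : IsCharacteristic E ε x₀ v₀ x v)
    (hE : IsLipField E M L K) (hε : 0 < ε) {s t T : ℝ} (hs : 0 ≤ s) (hst : s ≤ t) (htT : t ≤ T) :
    ‖v s‖ ≤ velocityAmplitude M L K ε ‖v₀‖ T * Real.exp (K * t) :=
  (h.norm_v_le hE hε hs).trans (velocityAmplitude_mul_exp_le hE.M_nonneg hE.L_nonneg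
    hE.K_nonneg hε.le (norm_nonneg _) hs hst htT)

theorem IsCharacteristic.norm_v_le_of_mem_step (h : IsCharacteristic E ε x₀ v₀ x v)
    (hE : IsLipField E M L K) (hε : 0 < ε) (hτ : 0 < τ) (hkn : k < n) :
    ∀ s ∈ Icc (k * τ) (k * τ + τ),
      ‖v s‖ ≤ velocityAmplitude M L K ε ‖v₀‖ (n * τ) * Real.exp (K * ((k + 1 : ℕ) * τ)) :=
  fun s hs => h.norm_v_le_of_le hE hε ((by positivity : (0 : ℝ) ≤ k * τ).trans hs.1)
    (hs.2.trans_eq (by push_cast; ring)) (by gcongr; exact hkn)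

/-- The error at time step `k` in the norm `‖y‖ + ε ‖v‖`, which controls the error on
`x = y + ε v^⊥`. -/
noncomputable def phaseError (ε τ : ℝ) (x v : ℝ → Plane) (yd vd : ℕ → Plane) (k : ℕ) : ℝ :=
  ‖yd k - guidingCenter ε x v (k * τ)‖ + ε * ‖vd k - v (k * τ)‖

theorem norm_x_error_le_phaseError (hε : 0 ≤ ε) (x v : ℝ → Plane) (yd vd : ℕ → Plane) (k : ℕ) :
    ‖yd k + ε • perp (vd k) - x (k * τ)‖ ≤ phaseError ε τ x v yd vd k := by
  rw [← guidingCenter_add ε x v, add_sub_add_comm, ← smul_sub, ← perp_sub]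
  refine (norm_add_le _ _).trans_eq ?_
  rw [norm_smul_perp hε, phaseError]

theorem IsScheme.velocityError_succ_le (hd : IsScheme E ε τ x₀ v₀ yd vd)
    (hE : IsLipField E M L K) (h : IsCharacteristic E ε x₀ v₀ x v) (hε : 0 < ε) (hτ : 0 < τ)
    (hW : ∀ s ∈ Icc (k * τ) (k * τ + τ), ‖v s‖ ≤ W) :
    ε * ‖vd (k + 1) - v ((k + 1 : ℕ) * τ)‖ ≤
      ε * ‖vd k - v (k * τ)‖ + K * τ * phaseError ε τ x v yd vd k +
        τ ^ 2 * (L + K * W / ε + M / ε ^ 2 + W / ε ^ 3) := by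
  have hk : (0 : ℝ) ≤ k * τ := by positivity
  have hconsistent := h.norm_v_consistency_le hE hε hτ.le hk hW
  rw [← add_one_mul, ← Nat.cast_succ] at hconsistent
  set w := v ((k + 1 : ℕ) * τ)
  set r := w + (τ / ε ^ 2) • perp w - (v (k * τ) + (τ / ε) • E (k * τ, x (k * τ)))
  have hfield : ‖E (k * τ, yd k + ε • perp (vd k)) - E (k * τ, x (k * τ))‖ ≤
      K * phaseError ε τ x v yd vd k :=
    (hE.lip_x _ _ _ hk).trans
      (mul_le_mul_of_nonneg_left (norm_x_error_le_phaseError hε.le x v yd vd k) hE.K_nonneg)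
  have hsplit : vd (k + 1) - w + (τ / ε ^ 2) • perp (vd (k + 1) - w) =
      (vd k - v (k * τ)) +
        (τ / ε) • (E (k * τ, yd k + ε • perp (vd k)) - E (k * τ, x (k * τ))) - r := by
    rw [perp_sub]
    linear_combination (norm := module) hd.v_succ hε hτ k
  calc ε * ‖vd (k + 1) - w‖
      ≤ ε * (‖vd k - v (k * τ)‖ + τ / ε * (K * phaseError ε τ x v yd vd k) +
          τ * (τ * (L / ε + K * W / ε ^ 2 + M / ε ^ 3 + W / ε ^ 4))) := by
        gcongr
        refine (norm_le_norm_add_smul_perp (τ / ε ^ 2) _).trans ?_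
        rw [hsplit]
        refine (norm_sub_le _ _).trans (add_le_add ((norm_add_le _ _).trans ?_) hconsistent)
        rw [norm_smul, Real.norm_of_nonneg (by positivity)]
        gcongr
    _ = _ := by field_simp

theorem IsScheme.guidingCenterError_succ_le (hd : IsScheme E ε τ x₀ v₀ yd vd)
    (hE : IsLipField E M L K) (h : IsCharacteristic E ε x₀ v₀ x v) (hε : 0 < ε) (hτ : 0 < τ)
    (hW : ∀ s ∈ Icc (k * τ) (k * τ + τ), ‖v s‖ ≤ W) :
    ‖yd (k + 1) - guidingCenter ε x v ((k + 1 : ℕ) * τ)‖ ≤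
      ‖yd k - guidingCenter ε x v (k * τ)‖ +
        K * τ * (‖yd k - guidingCenter ε x v (k * τ)‖ +
          ε * ‖vd (k + 1) - v ((k + 1 : ℕ) * τ)‖) +
        τ ^ 2 * (L + 2 * K * M + K * W / ε) := by
  have hk : (0 : ℝ) ≤ k * τ := by positivity
  have hK := hE.K_nonneg
  have hconsistent := h.norm_guidingCenter_consistency_le hE hε hτ.le hk hW
  rw [← add_one_mul, ← Nat.cast_succ] at hconsistent
  set y := guidingCenter ε x v (k * τ)
  set w := v ((k + 1 : ℕ) * τ)
  set r := guidingCenter ε x v ((k + 1 : ℕ) * τ) - (y - τ • perp (E (k * τ, y + ε • perp w)))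
  have hfield : ‖E (k * τ, yd k + ε • perp (vd (k + 1))) - E (k * τ, y + ε • perp w)‖ ≤
      K * (‖yd k - y‖ + ε * ‖vd (k + 1) - w‖) := by
    refine (hE.lip_x _ _ _ hk).trans ?_
    gcongr
    rw [add_sub_add_comm, ← smul_sub, ← perp_sub]
    refine (norm_add_le _ _).trans_eq ?_
    rw [norm_smul_perp hε.le]
  have hsplit : yd (k + 1) - guidingCenter ε x v ((k + 1 : ℕ) * τ) = (yd k - y) -
      τ • perp (E (k * τ, yd k + ε • perp (vd (k + 1))) - E (k * τ, y + ε • perp w)) - r := by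
    rw [hd.y_succ hτ k, perp_sub]
    module
  calc _ ≤ ‖yd k - y‖ + τ * (K * (‖yd k - y‖ + ε * ‖vd (k + 1) - w‖)) +
        τ * (τ * (L + 2 * K * M + K * W / ε)) := by
        rw [hsplit]
        refine (norm_sub_le _ _).trans (add_le_add ((norm_sub_le _ _).trans ?_) hconsistent)
        rw [norm_smul_perp hτ.le]
        gcongr
    _ = _ := by ring

theorem IsScheme.phaseError_succ_le (hd : IsScheme E ε τ x₀ v₀ yd vd) (hE : IsLipField E M L K)
    (h : IsCharacteristic E ε x₀ v₀ x v) (hε : 0 < ε) (hτ : 0 < τ) (hW₀ : 0 ≤ W)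
    (hW : ∀ s ∈ Icc (k * τ) (k * τ + τ), ‖v s‖ ≤ W) :
    phaseError ε τ x v yd vd (k + 1) ≤ (1 + K * τ) ^ 2 * phaseError ε τ x v yd vd k +
      τ * (τ * (2 * L + 2 * K * M + M / ε ^ 2 + (2 * K / ε + 1 / ε ^ 3) * W) * (1 + K * τ)) := by
  have hM := hE.M_nonneg
  have hL := hE.L_nonneg
  have hK := hE.K_nonneg
  have hv := mul_le_mul_of_nonneg_left (hd.velocityError_succ_le hE h hε hτ hW)
    (by positivity : 0 ≤ 1 + K * τ)
  have hy := hd.guidingCenterError_succ_le hE h hε hτ hW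
  have hslack : 0 ≤ K * τ * (τ ^ 2 * (L + 2 * K * M + K * W / ε)) := by positivity
  rw [show (2 * K / ε + 1 / ε ^ 3) * W = 2 * (K * W / ε) + W / ε ^ 3 by field_simp]
  simp only [phaseError] at hv ⊢
  linarith

theorem IsScheme.phaseError_le (hd : IsScheme E ε τ x₀ v₀ yd vd) (hE : IsLipField E M L K)
    (h : IsCharacteristic E ε x₀ v₀ x v) (hε : 0 < ε) (hτ : 0 < τ) (n : ℕ) :
    phaseError ε τ x v yd vd n ≤
      n * τ * (τ * (2 * L + 2 * K * M + M / ε ^ 2 +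
        (2 * K / ε + 1 / ε ^ 3) * velocityAmplitude M L K ε ‖v₀‖ (n * τ))) *
        Real.exp (2 * K * (n * τ)) := by
  have hM := hE.M_nonneg
  have hL := hE.L_nonneg
  have hK := hE.K_nonneg
  set Q := velocityAmplitude M L K ε ‖v₀‖ (n * τ)
  have hQ : 0 ≤ Q :=
    velocityAmplitude_nonneg hM hL hK hε.le (norm_nonneg _) (by positivity)
  have hzero : phaseError ε τ x v yd vd 0 = 0 := by
    simp [phaseError, guidingCenter, h.init_x, h.init_v, hd.init_y, hd.init_v]
  have hstep : 1 + K * τ ≤ Real.exp (K * τ) := by linarith [Real.add_one_le_exp (K * τ)]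
  refine (le_mul_exp_of_le_exp_mul_add (q := 2 * K) (τ := τ) (D := τ * (2 * L + 2 * K * M +
    M / ε ^ 2 + (2 * K / ε + 1 / ε ^ 3) * Q)) fun k hk => ?_).trans_eq (by rw [hzero, zero_add])
  set X := Real.exp (K * ((k + 1 : ℕ) * τ)) with hX
  have hone : 1 ≤ X := Real.one_le_exp (by positivity)
  have hstepX : 1 + K * τ ≤ X :=
    hstep.trans (Real.exp_le_exp.2 (by push_cast; nlinarith [mul_nonneg hK hτ.le]))
  refine (hd.phaseError_succ_le hE h hε hτ (by positivity)
    (h.norm_v_le_of_mem_step hE hε hτ hk)).trans (add_le_add ?_ ?_)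
  · rw [mul_assoc 2 K τ, two_mul, Real.exp_add, ← sq]
    gcongr
    simp only [phaseError]
    positivity
  · have hexp : Real.exp (2 * K * ((k + 1 : ℕ) * τ)) = X * X := by
      rw [hX, ← Real.exp_add]
      ring_nf
    have hsource : 2 * L + 2 * K * M + M / ε ^ 2 ≤ (2 * L + 2 * K * M + M / ε ^ 2) * X :=
      le_mul_of_one_le_right (by positivity) hone
    calc _ ≤ τ * (τ * ((2 * L + 2 * K * M + M / ε ^ 2 + (2 * K / ε + 1 / ε ^ 3) * Q) * X) * X) := by
          gcongr
          linarith
      _ = _ := by rw [hexp]; ring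

/-- Two perturbed explicit Euler schemes for `y' = -f(y)`: the perturbations are a defect of size
`d`, `d'` per unit time, and a discrepancy `c` between the iterates `G`, `F` and the points `y`,
`Y` at which `f` is evaluated. -/
theorem norm_sub_le_of_eulerDefect_le {V : Type*} [NormedAddCommGroup V] [NormedSpace ℝ V]
    {f : ℕ → V → V} {G F y Y : ℕ → V} {K τ c d d' q : ℝ} {n : ℕ} (hK : 0 ≤ K) (hKq : K ≤ q)
    (hτ : 0 ≤ τ) (hf : ∀ k z w, ‖f k z - f k w‖ ≤ K * ‖z - w‖) (hzero : G 0 = F 0)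
    (hG : ∀ k < n, ‖G (k + 1) - (G k - τ • f k (y k))‖ ≤
      τ * (d * Real.exp (q * ((k + 1 : ℕ) * τ))))
    (hF : ∀ k < n, ‖F (k + 1) - (F k - τ • f k (Y k))‖ ≤
      τ * (d' * Real.exp (q * ((k + 1 : ℕ) * τ))))
    (hdiscrepancy : ∀ k < n, ‖(y k - Y k) - (G k - F k)‖ ≤
      c * Real.exp (q * ((k + 1 : ℕ) * τ))) :
    ‖G n - F n‖ ≤ n * τ * (K * c + d + d') * Real.exp (q * (n * τ)) := by
  refine (le_mul_exp_of_le_exp_mul_add (s := fun k => ‖G k - F k‖) (q := q) (τ := τ)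
    (D := K * c + d + d') fun k hk => ?_).trans_eq (by simp [hzero])
  set X := Real.exp (q * ((k + 1 : ℕ) * τ))
  have hfield : ‖f k (y k) - f k (Y k)‖ ≤ K * (‖G k - F k‖ + c * X) := by
    refine (hf k _ _).trans (mul_le_mul_of_nonneg_left ?_ hK)
    rw [← add_sub_cancel (G k - F k) (y k - Y k)]
    exact (norm_add_le _ _).trans (add_le_add_right (hdiscrepancy k hk) _)
  have hstep : 1 + K * τ ≤ Real.exp (q * τ) := by
    linarith [Real.add_one_le_exp (q * τ), mul_le_mul_of_nonneg_right hKq hτ]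
  have hsplit : G (k + 1) - F (k + 1) = (G k - F k) - τ • (f k (y k) - f k (Y k)) +
      (G (k + 1) - (G k - τ • f k (y k))) - (F (k + 1) - (F k - τ • f k (Y k))) := by
    module
  calc ‖G (k + 1) - F (k + 1)‖
      ≤ ‖G k - F k‖ + τ * (K * (‖G k - F k‖ + c * X)) + τ * (d * X) + τ * (d' * X) := by
        rw [hsplit]
        refine (norm_sub_le _ _).trans (add_le_add ((norm_add_le _ _).trans (add_le_add
          ((norm_sub_le _ _).trans (add_le_add_right ?_ _)) (hG k hk))) (hF k hk))
        rw [norm_smul, Real.norm_of_nonneg hτ]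
        gcongr
    _ = (1 + K * τ) * ‖G k - F k‖ + τ * (K * c + d + d') * X := by ring
    _ ≤ _ := by gcongr

theorem IsLipField.norm_perp_sub_le (hE : IsLipField E M L K) {t : ℝ} (ht : 0 ≤ t) (z w : Plane) :
    ‖perp (E (t, z)) - perp (E (t, w))‖ ≤ K * ‖z - w‖ := by
  rw [← perp_sub, norm_perp]
  exact hE.lip_x t z w ht

theorem IsScheme.norm_y_limit_consistency_le (hd : IsScheme E ε τ x₀ v₀ yd vd)
    (hE : IsLipField E M L K) (hε : 0 ≤ ε) (hτ : 0 < τ) (hW : ‖vd (k + 1)‖ ≤ W) :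
    ‖yd (k + 1) - (yd k - τ • perp (E (k * τ, yd k)))‖ ≤ τ * (K * ε * W) := by
  have hK := hE.K_nonneg
  rw [hd.y_succ hτ k, sub_sub_sub_cancel_left, ← smul_sub, ← perp_sub, norm_smul_perp hτ.le,
    norm_sub_rev, mul_assoc K]
  gcongr
  refine (hE.lip_x _ _ _ (by positivity)).trans ?_
  rw [add_sub_cancel_left, norm_smul_perp hε]
  gcongr

theorem IsScheme.guidingCenterError_le (hd : IsScheme E ε τ x₀ v₀ yd vd)
    (hE : IsLipField E M L K) (h : IsCharacteristic E ε x₀ v₀ x v) (hε : 0 < ε) (hτ : 0 < τ)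
    (n : ℕ) :
    ‖yd n - guidingCenter ε x v (n * τ)‖ ≤
      n * τ * (τ * (L + K * M) + 2 * K * ε * velocityAmplitude M L K ε ‖v₀‖ (n * τ)) *
        Real.exp (K * (n * τ)) := by
  have hM := hE.M_nonneg
  have hL := hE.L_nonneg
  have hK := hE.K_nonneg
  set Q := velocityAmplitude M L K ε ‖v₀‖ (n * τ)
  refine (norm_sub_le_of_eulerDefect_le (f := fun k z => perp (E (k * τ, z)))
    (F := fun k => guidingCenter ε x v (k * τ)) (y := yd)
    (Y := fun k => guidingCenter ε x v (k * τ)) (c := 0) (d := K * ε * Q)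
    (d' := τ * (L + K * M) + K * ε * Q) hK le_rfl hτ.le
    (fun k => hE.norm_perp_sub_le (by positivity)) ?_ (fun k hk => ?_) (fun k hk => ?_)
    (fun k _ => by simp)).trans_eq (by ring)
  · simp [guidingCenter, h.init_x, h.init_v, hd.init_y]
  · rw [mul_assoc (K * ε)]
    exact hd.norm_y_limit_consistency_le hE hε.le hτ (hd.norm_v_le_of_le hE hε hτ hk)
  · have hconsistent := h.norm_guidingCenter_limit_consistency_le hE hε hτ.le (by positivity)
      (h.norm_v_le_of_mem_step hE hε hτ hk)
    rw [← add_one_mul, ← Nat.cast_succ] at hconsistent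
    refine hconsistent.trans (mul_le_mul_of_nonneg_left ?_ hτ.le)
    rw [add_mul, mul_assoc (K * ε)]
    exact add_le_add_left
      (le_mul_of_one_le_right (by positivity) (Real.one_le_exp (by positivity))) _

end FirstOrderEstimates

section SecondOrderEstimates

variable {E e : SpaceTime → Plane} {M L K H δ ε τ t W : ℝ} {x₀ v₀ : Plane} {x v : ℝ → Plane}
  {yd vd : ℕ → Plane} {k : ℕ}

/-- The spatial derivative `D_x e`. -/
noncomputable def spaceDeriv (e : SpaceTime → Plane) (z : SpaceTime) : Plane →L[ℝ] Plane :=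
  (fderiv ℝ e z).comp (ContinuousLinearMap.inr ℝ ℝ Plane)

theorem IsSmoothApprox.H_nonneg (he : IsSmoothApprox E e K H δ) : 0 ≤ H :=
  (fderiv ℝ (fderiv ℝ e) 0).opNorm_nonneg.trans (he.bound_fderiv_fderiv 0 le_rfl)

theorem IsSmoothApprox.differentiable_fderiv (he : IsSmoothApprox E e K H δ) :
    Differentiable ℝ (fderiv ℝ e) :=
  (he.contDiff.fderiv_right (m := 1) (by norm_cast)).differentiable one_ne_zero

theorem IsSmoothApprox.norm_fderiv_sub_le (he : IsSmoothApprox E e K H δ) {z w : SpaceTime}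
    (hz : 0 ≤ z.1) (hw : 0 ≤ w.1) : ‖fderiv ℝ e z - fderiv ℝ e w‖ ≤ H * ‖z - w‖ :=
  ((convex_Ici (0 : ℝ)).linear_preimage (LinearMap.fst ℝ ℝ Plane)
    ).norm_image_sub_le_of_norm_hasFDerivWithin_le
    (fun z _ => (he.differentiable_fderiv z).hasFDerivAt.hasFDerivWithinAt)
    he.bound_fderiv_fderiv hw hz

theorem norm_spaceTime_space (w : Plane) : ‖((0, w) : SpaceTime)‖ = ‖w‖ := by
  simp

theorem IsSmoothApprox.norm_spaceDeriv_sub_le (he : IsSmoothApprox E e K H δ) {z w : SpaceTime}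
    (hz : 0 ≤ z.1) (hw : 0 ≤ w.1) : ‖spaceDeriv e z - spaceDeriv e w‖ ≤ H * ‖z - w‖ := by
  have hH := he.H_nonneg
  refine ContinuousLinearMap.opNorm_le_bound _ (by positivity) fun h => ?_
  rw [← norm_spaceTime_space h]
  exact (fderiv ℝ e z - fderiv ℝ e w).le_of_opNorm_le (he.norm_fderiv_sub_le hz hw) (0, h)

theorem IsSmoothApprox.norm_taylor_space_le (he : IsSmoothApprox E e K H δ) (ht : 0 ≤ t)
    (y h : Plane) : ‖e (t, y + h) - e (t, y) - spaceDeriv e (t, y) h‖ ≤ H * ‖h‖ ^ 2 := by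
  have hH := he.H_nonneg
  have hderiv (w : Plane) : HasFDerivAt (fun w => e (t, w)) (spaceDeriv e (t, w)) w :=
    ((he.contDiff.differentiable (by simp)) (t, w)).hasFDerivAt.comp w
      (hasFDerivAt_prodMk_right t w)
  have hclose (w : Plane) (hw : w ∈ Metric.closedBall y ‖h‖) :
      ‖spaceDeriv e (t, w) - spaceDeriv e (t, y)‖ ≤ H * ‖h‖ := by
    refine (he.norm_spaceDeriv_sub_le (z := (t, w)) (w := (t, y)) ht ht).trans ?_
    rw [Prod.mk_sub_mk, sub_self, norm_spaceTime_space]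
    gcongr
    exact mem_closedBall_iff_norm.1 hw
  have hmvt := (convex_closedBall y ‖h‖).norm_image_sub_le_of_norm_hasFDerivWithin_le'
    (fun w _ => (hderiv w).hasFDerivWithinAt) hclose
    (Metric.mem_closedBall_self (norm_nonneg h))
    (show y + h ∈ Metric.closedBall y ‖h‖ by simp)
  rwa [add_sub_cancel_left, mul_assoc, ← sq] at hmvt

theorem IsSmoothApprox.norm_field_expansion_le (he : IsSmoothApprox E e K H δ) (hε : 0 ≤ ε)
    (ht : 0 ≤ t) (y : Plane) {w : Plane} (hw : ‖w‖ ≤ W) :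
    ‖E (t, y + ε • perp w) - E (t, y) - spaceDeriv e (t, y) (ε • perp w)‖ ≤
      2 * δ + H * (ε * W) ^ 2 := by
  have hH := he.H_nonneg
  rw [show E (t, y + ε • perp w) - E (t, y) - spaceDeriv e (t, y) (ε • perp w) =
    (E (t, y + ε • perp w) - e (t, y + ε • perp w)) - (E (t, y) - e (t, y)) +
      (e (t, y + ε • perp w) - e (t, y) - spaceDeriv e (t, y) (ε • perp w)) by abel]
  refine (norm_add_le _ _).trans (add_le_add ((norm_sub_le _ _).trans ?_)
    ((he.norm_taylor_space_le ht y _).trans ?_))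
  · linarith [he.close (t, y + ε • perp w) ht, he.close (t, y) ht]
  · rw [norm_smul_perp hε]
    gcongr

/-- The term which, subtracted from the guiding center `y`, removes the first order oscillation
`ε D_x e(t, y) v^⊥` from its drift. -/
noncomputable def corrector (e : SpaceTime → Plane) (ε t : ℝ) (y v : Plane) : Plane :=
  ε ^ 3 • perp (spaceDeriv e (t, y) v)

theorem IsSmoothApprox.norm_corrector_le (he : IsSmoothApprox E e K H δ) (hK : 0 ≤ K)
    (hε : 0 ≤ ε) (ht : 0 ≤ t) (y : Plane) {w : Plane} (hw : ‖w‖ ≤ W) :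
    ‖corrector e ε t y w‖ ≤ ε ^ 3 * (K * W) := by
  rw [corrector, norm_smul_perp (by positivity)]
  gcongr
  exact (he.bound_fderiv (t, y) ht w).trans (by gcongr)

/-- A bound on the drift that remains after averaging, for velocities of size at most `W` and a
smooth approximation at distance `ε ^ 2`. -/
noncomputable def averagingError (M K H ε W : ℝ) : ℝ :=
  ε ^ 2 * (2 + K * M + H * W ^ 2 + ε * H * (1 + M) * W)

theorem averagingError_mul_exp_le {r : ℝ} (hM : 0 ≤ M) (hK : 0 ≤ K) (hH : 0 ≤ H) (hε : 0 ≤ ε)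
    (hW : 0 ≤ W) (hr : 0 ≤ r) :
    averagingError M K H ε (W * Real.exp r) ≤ averagingError M K H ε W * Real.exp (2 * r) := by
  set X := Real.exp r with hX
  have hone : 1 ≤ X := Real.one_le_exp hr
  have hconst : 2 + K * M ≤ (2 + K * M) * (X * X) :=
    le_mul_of_one_le_right (by positivity) (one_le_mul_of_one_le_of_one_le hone hone)
  have hlinear : ε * H * (1 + M) * W * X ≤ ε * H * (1 + M) * W * (X * X) := by
    gcongr
    exact le_mul_of_one_le_right (by positivity) hone
  rw [two_mul, Real.exp_add, ← hX, averagingError, averagingError, mul_assoc (ε ^ 2)]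
  refine mul_le_mul_of_nonneg_left ?_ (sq_nonneg ε)
  linarith

/-- The drift that remains once the corrector has absorbed the oscillation: the Taylor remainder
of the field, and the derivative of the corrector along the slow variables. -/
noncomputable def averagingRemainder (E e : SpaceTime → Plane) (ε t : ℝ) (y v : Plane) : Plane :=
  E (t, y + ε • perp v) - E (t, y) - spaceDeriv e (t, y) (ε • perp v) +
    ε ^ 3 • fderiv ℝ (fderiv ℝ e) (t, y) (1, -perp (E (t, y + ε • perp v))) (0, v) +
    ε ^ 2 • spaceDeriv e (t, y) (E (t, y + ε • perp v))

theorem IsSmoothApprox.norm_averagingRemainder_le (he : IsSmoothApprox E e K H (ε ^ 2))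
    (hE : IsLipField E M L K) (hε : 0 ≤ ε) (ht : 0 ≤ t) (y : Plane) {w : Plane} (hw : ‖w‖ ≤ W) :
    ‖averagingRemainder E e ε t y w‖ ≤ averagingError M K H ε W := by
  have hM := hE.M_nonneg
  have hK := hE.K_nonneg
  have hH := he.H_nonneg
  set F := E (t, y + ε • perp w)
  have hF : ‖F‖ ≤ M := hE.bound _ _ ht
  have hdirection : ‖((1, -perp F) : SpaceTime)‖ ≤ 1 + M := by
    rw [Prod.norm_def, norm_neg, norm_perp, norm_one]
    exact max_le (by linarith) (by linarith)
  have hsecond : ‖fderiv ℝ (fderiv ℝ e) (t, y) (1, -perp F) (0, w)‖ ≤ H * (1 + M) * W :=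
    ContinuousLinearMap.le_of_opNorm_le_of_le _
      ((fderiv ℝ (fderiv ℝ e) (t, y)).le_of_opNorm_le_of_le (he.bound_fderiv_fderiv (t, y) ht)
        hdirection) ((norm_spaceTime_space w).trans_le hw)
  calc _ ≤ 2 * ε ^ 2 + H * (ε * W) ^ 2 + ε ^ 3 * (H * (1 + M) * W) + ε ^ 2 * (K * M) := by
        refine norm_add₃_le.trans
          (add_le_add (add_le_add (he.norm_field_expansion_le hε ht y hw) ?_) ?_)
        · rw [norm_smul, Real.norm_of_nonneg (by positivity)]
          gcongr
        · rw [norm_smul, Real.norm_of_nonneg (by positivity)]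
          gcongr
          exact (he.bound_fderiv (t, y) ht F).trans (by gcongr)
    _ = _ := by rw [averagingError]; ring

theorem IsCharacteristic.hasDerivWithinAt_guidingCenter_sub_corrector
    (h : IsCharacteristic E ε x₀ v₀ x v) (he : IsSmoothApprox E e K H δ) (hε : 0 < ε) (s : ℝ)
    (hs : 0 ≤ s) :
    HasDerivWithinAt
      (fun s => guidingCenter ε x v s - corrector e ε s (guidingCenter ε x v s) (v s))
      (-perp (E (s, guidingCenter ε x v s) +
        averagingRemainder E e ε s (guidingCenter ε x v s) (v s))) (Ici 0) s := by
  set Y := guidingCenter ε x v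
  have hY : HasDerivWithinAt Y (-perp (E (s, x s))) (Ici 0) s :=
    h.hasDerivWithinAt_guidingCenter hε s hs
  have hfderiv : HasDerivWithinAt (fun s => fderiv ℝ e (s, Y s))
      (fderiv ℝ (fderiv ℝ e) (s, Y s) (1, -perp (E (s, x s)))) (Ici 0) s :=
    (he.differentiable_fderiv (s, Y s)).hasFDerivAt.comp_hasDerivWithinAt s
      ((hasDerivWithinAt_id s _).prodMk hY)
  have hdirection := (hasDerivWithinAt_const s (Ici 0) (0 : ℝ)).prodMk (h.deriv_v s hs)
  refine (hY.sub ((perpCLM.hasFDerivAt.comp_hasDerivWithinAt s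
    (hfderiv.clm_apply hdirection)).const_smul (ε ^ 3))).congr_deriv ?_
  change _ - ε ^ 3 • perp (_ + spaceDeriv e (s, Y s) (ε⁻¹ • (E (s, x s) - ε⁻¹ • perp (v s)))) = _
  rw [averagingRemainder, guidingCenter_add]
  simp only [map_smul, map_sub, perp_add, perp_sub, perp_smul]
  match_scalars <;> field_simp
  ring

theorem IsCharacteristic.norm_averaged_consistency_le (h : IsCharacteristic E ε x₀ v₀ x v)
    (hE : IsLipField E M L K) (he : IsSmoothApprox E e K H (ε ^ 2)) (hε : 0 < ε) (hτ : 0 ≤ τ)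
    (ht : 0 ≤ t) (hW : ∀ s ∈ Icc t (t + τ), ‖v s‖ ≤ W) :
    ‖guidingCenter ε x v (t + τ) -
          corrector e ε (t + τ) (guidingCenter ε x v (t + τ)) (v (t + τ)) -
        (guidingCenter ε x v t - corrector e ε t (guidingCenter ε x v t) (v t) -
          τ • perp (E (t, guidingCenter ε x v t)))‖ ≤
      τ * (averagingError M K H ε W + τ * (L + K * M)) := by
  have hK := hE.K_nonneg
  set Y := guidingCenter ε x v
  refine le_of_eq_of_le (congrArg norm ?_) (norm_sub_sub_smul_le_of_norm_deriv_sub_le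
    (h.hasDerivWithinAt_guidingCenter_sub_corrector he hε) ht hτ (c := -perp (E (t, Y t)))
    fun s hs => ?_)
  · module
  have hs₀ : 0 ≤ s := ht.trans hs.1
  have hfield : ‖E (s, Y s) - E (t, Y t)‖ ≤ L * τ + K * (M * τ) :=
    (hE.norm_sub_le_of_mem ht hs _ _).trans (by
      gcongr
      exact h.norm_guidingCenter_sub_le hE hε ht hs (left_mem_Icc.2 (le_add_of_nonneg_right hτ)))
  calc _ = ‖averagingRemainder E e ε s (Y s) (v s) + (E (s, Y s) - E (t, Y t))‖ := by
        rw [← neg_sub', norm_neg, ← perp_sub, norm_perp, add_comm (E _), add_sub_assoc]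
    _ ≤ averagingError M K H ε W + (L * τ + K * (M * τ)) := (norm_add_le _ _).trans
        (add_le_add (he.norm_averagingRemainder_le hE hε.le hs₀ (Y s) (hW s hs)) hfield)
    _ = _ := by ring

theorem IsScheme.sub_corrector_succ (hd : IsScheme E ε τ x₀ v₀ yd vd) (e : SpaceTime → Plane)
    (hε : 0 < ε) (hτ : 0 < τ) (k : ℕ) :
    yd (k + 1) - corrector e ε ((k + 1 : ℕ) * τ) (yd (k + 1)) (vd (k + 1)) -
        (yd k - corrector e ε (k * τ) (yd k) (vd k) - τ • perp (E (k * τ, yd k))) =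
      -perp (τ • (E (k * τ, yd k + ε • perp (vd (k + 1))) - E (k * τ, yd k) -
          spaceDeriv e (k * τ, yd k) (ε • perp (vd (k + 1)))) +
        ε ^ 3 • (spaceDeriv e ((k + 1 : ℕ) * τ, yd (k + 1)) - spaceDeriv e (k * τ, yd k))
          (vd (k + 1)) +
        (τ * ε ^ 2) • spaceDeriv e (k * τ, yd k) (E (k * τ, yd k + ε • perp (vd k)))) := by
  have hv := congrArg (spaceDeriv e (k * τ, yd k)) (hd.v_succ hε hτ k)
  simp only [map_add, map_smul] at hv
  rw [corrector, corrector, hd.y_succ hτ k, eq_sub_of_add_eq hv.symm]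
  simp only [map_smul, sub_apply, perp_add, perp_sub, perp_smul]
  match_scalars <;> field_simp
  ring

theorem IsScheme.norm_spaceDeriv_succ_sub_le (hd : IsScheme E ε τ x₀ v₀ yd vd)
    (hE : IsLipField E M L K) (he : IsSmoothApprox E e K H δ) (hτ : 0 < τ) (k : ℕ) :
    ‖spaceDeriv e ((k + 1 : ℕ) * τ, yd (k + 1)) - spaceDeriv e (k * τ, yd k)‖ ≤
      τ * (H * (1 + M)) := by
  have hM := hE.M_nonneg
  have hH := he.H_nonneg
  have hy : ‖yd (k + 1) - yd k‖ ≤ τ * M := by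
    rw [hd.y_succ hτ k, sub_sub_cancel_left, norm_neg, norm_smul_perp hτ.le]
    gcongr
    exact hE.bound _ _ (by positivity)
  have hstep : ‖((((k + 1 : ℕ) * τ, yd (k + 1)) : SpaceTime) - (k * τ, yd k))‖ ≤ τ * (1 + M) := by
    have hτM : 0 ≤ τ * M := by positivity
    rw [Prod.mk_sub_mk, ← sub_mul, Nat.cast_succ, add_sub_cancel_left, one_mul, Prod.norm_def,
      Real.norm_of_nonneg hτ.le]
    exact max_le (by linarith) (by linarith)
  calc _ ≤ H * (τ * (1 + M)) := (he.norm_spaceDeriv_sub_le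
        (by dsimp only; positivity) (by dsimp only; positivity)).trans (by gcongr)
    _ = _ := by ring

theorem IsScheme.norm_averaged_consistency_le (hd : IsScheme E ε τ x₀ v₀ yd vd)
    (hE : IsLipField E M L K) (he : IsSmoothApprox E e K H (ε ^ 2)) (hε : 0 < ε) (hτ : 0 < τ)
    (hW : ‖vd (k + 1)‖ ≤ W) :
    ‖yd (k + 1) - corrector e ε ((k + 1 : ℕ) * τ) (yd (k + 1)) (vd (k + 1)) -
        (yd k - corrector e ε (k * τ) (yd k) (vd k) - τ • perp (E (k * τ, yd k)))‖ ≤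
      τ * averagingError M K H ε W := by
  have hM := hE.M_nonneg
  have hK := hE.K_nonneg
  have hH := he.H_nonneg
  have hk : (0 : ℝ) ≤ k * τ := by positivity
  rw [hd.sub_corrector_succ e hε hτ k, norm_neg, norm_perp]
  calc _ ≤ τ * (2 * ε ^ 2 + H * (ε * W) ^ 2) + ε ^ 3 * (τ * (H * (1 + M)) * W) +
        τ * ε ^ 2 * (K * M) := by
        refine norm_add₃_le.trans (add_le_add (add_le_add ?_ ?_) ?_) <;>
          rw [norm_smul, Real.norm_of_nonneg (by positivity)] <;> gcongr
        · exact he.norm_field_expansion_le hε.le hk (yd k) hW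
        · exact ContinuousLinearMap.le_of_opNorm_le_of_le _
            (hd.norm_spaceDeriv_succ_sub_le hE he hτ k) hW
        · exact (he.bound_fderiv (k * τ, yd k) hk _).trans
            (mul_le_mul_of_nonneg_left (hE.bound _ _ hk) hK)
    _ = _ := by rw [averagingError]; ring

theorem IsScheme.norm_corrector_sub_corrector_le (hd : IsScheme E ε τ x₀ v₀ yd vd)
    (hE : IsLipField E M L K) (h : IsCharacteristic E ε x₀ v₀ x v)
    (he : IsSmoothApprox E e K H δ) (hε : 0 < ε) (hτ : 0 < τ) {n : ℕ} (hkn : k ≤ n) :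
    ‖corrector e ε (k * τ) (yd k) (vd k) -
        corrector e ε (k * τ) (guidingCenter ε x v (k * τ)) (v (k * τ))‖ ≤
      2 * ε ^ 3 * K * velocityAmplitude M L K ε ‖v₀‖ (n * τ) * Real.exp (K * (k * τ)) := by
  have hk : (0 : ℝ) ≤ k * τ := by positivity
  have hv := h.norm_v_le_of_le hE hε hk le_rfl (T := n * τ) (by gcongr)
  refine (norm_sub_le_of_le
    (he.norm_corrector_le hE.K_nonneg hε.le hk _ (hd.norm_v_le_of_le hE hε hτ hkn))
    (he.norm_corrector_le hE.K_nonneg hε.le hk _ hv)).trans_eq (by ring)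

theorem IsScheme.norm_guidingCenterError_sub_corrector_le (hd : IsScheme E ε τ x₀ v₀ yd vd)
    (hE : IsLipField E M L K) (h : IsCharacteristic E ε x₀ v₀ x v)
    (he : IsSmoothApprox E e K H (ε ^ 2)) (hε : 0 < ε) (hτ : 0 < τ) (n : ℕ) :
    ‖(yd n - corrector e ε (n * τ) (yd n) (vd n)) - (guidingCenter ε x v (n * τ) -
        corrector e ε (n * τ) (guidingCenter ε x v (n * τ)) (v (n * τ)))‖ ≤
      n * τ * (K * (2 * ε ^ 3 * K * velocityAmplitude M L K ε ‖v₀‖ (n * τ)) +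
        averagingError M K H ε (velocityAmplitude M L K ε ‖v₀‖ (n * τ)) +
        (averagingError M K H ε (velocityAmplitude M L K ε ‖v₀‖ (n * τ)) + τ * (L + K * M))) *
        Real.exp (2 * K * (n * τ)) := by
  have hM := hE.M_nonneg
  have hL := hE.L_nonneg
  have hK := hE.K_nonneg
  have hH := he.H_nonneg
  set Q := velocityAmplitude M L K ε ‖v₀‖ (n * τ)
  have hQ : 0 ≤ Q :=
    velocityAmplitude_nonneg hM hL hK hε.le (norm_nonneg _) (by positivity)
  set Y := guidingCenter ε x v
  have haveraging (k : ℕ) : averagingError M K H ε (Q * Real.exp (K * ((k + 1 : ℕ) * τ))) ≤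
      averagingError M K H ε Q * Real.exp (2 * K * ((k + 1 : ℕ) * τ)) :=
    (averagingError_mul_exp_le hM hK hH hε.le hQ (by positivity)).trans_eq (by rw [mul_assoc 2 K])
  refine norm_sub_le_of_eulerDefect_le (f := fun k z => perp (E (k * τ, z)))
    (G := fun k => yd k - corrector e ε (k * τ) (yd k) (vd k))
    (F := fun k => Y (k * τ) - corrector e ε (k * τ) (Y (k * τ)) (v (k * τ))) (y := yd)
    (Y := fun k => Y (k * τ)) hK (by linarith) hτ.le
    (fun k => hE.norm_perp_sub_le (by positivity)) ?_ (fun k hk => ?_) (fun k hk => ?_)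
    (fun k hk => ?_)
  · simp [Y, guidingCenter, h.init_x, h.init_v, hd.init_y, hd.init_v]
  · exact (hd.norm_averaged_consistency_le hE he hε hτ (hd.norm_v_le_of_le hE hε hτ hk)).trans
      (mul_le_mul_of_nonneg_left (haveraging k) hτ.le)
  · have hconsistent := h.norm_averaged_consistency_le hE he hε hτ.le (by positivity)
      (h.norm_v_le_of_mem_step hE hε hτ hk)
    rw [← add_one_mul, ← Nat.cast_succ] at hconsistent
    refine hconsistent.trans (mul_le_mul_of_nonneg_left ?_ hτ.le)
    rw [add_mul]
    exact add_le_add (haveraging k)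
      (le_mul_of_one_le_right (by positivity) (Real.one_le_exp (by positivity)))
  · refine (congrArg norm ?_).trans_le
      ((hd.norm_corrector_sub_corrector_le hE h he hε hτ hk.le).trans ?_)
    · abel
    gcongr
    · linarith
    · exact k.le_succ

theorem IsScheme.guidingCenterError_le_sq (hd : IsScheme E ε τ x₀ v₀ yd vd)
    (hE : IsLipField E M L K) (h : IsCharacteristic E ε x₀ v₀ x v)
    (he : IsSmoothApprox E e K H (ε ^ 2)) (hε : 0 < ε) (hτ : 0 < τ) (n : ℕ) :
    ‖yd n - guidingCenter ε x v (n * τ)‖ ≤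
      (n * τ * (τ * (L + K * M) +
          2 * averagingError M K H ε (velocityAmplitude M L K ε ‖v₀‖ (n * τ))) +
        2 * K * (1 + K * (n * τ)) * (ε ^ 3 * velocityAmplitude M L K ε ‖v₀‖ (n * τ))) *
        Real.exp (2 * K * (n * τ)) := by
  have hK := hE.K_nonneg
  set Q := velocityAmplitude M L K ε ‖v₀‖ (n * τ)
  set Y := guidingCenter ε x v (n * τ)
  set X := Real.exp (2 * K * (n * τ))
  have hQ : 0 ≤ Q := velocityAmplitude_nonneg hE.M_nonneg hE.L_nonneg hK hε.le (norm_nonneg _)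
    (by positivity)
  have hcorrector : ‖corrector e ε (n * τ) (yd n) (vd n) -
      corrector e ε (n * τ) Y (v (n * τ))‖ ≤ 2 * ε ^ 3 * K * Q * X :=
    (hd.norm_corrector_sub_corrector_le hE h he hε hτ le_rfl).trans
      (mul_le_mul_of_nonneg_left (Real.exp_le_exp.2 (by
        gcongr
        linarith)) (by positivity))
  rw [← sub_add_cancel (yd n - Y) (corrector e ε (n * τ) (yd n) (vd n) -
    corrector e ε (n * τ) Y (v (n * τ))), sub_sub_sub_comm]
  exact (norm_add_le_of_le (hd.norm_guidingCenterError_sub_corrector_le hE h he hε hτ n)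
    hcorrector).trans_eq (by ring)

end SecondOrderEstimates

section UniformConstants

variable {M L K H A N D Q T b ε τ : ℝ}

theorem velocityAmplitude_le (hM : 0 ≤ M) (hL : 0 ≤ L) (hK : 0 ≤ K) (hε : 0 ≤ ε) (hb : 0 ≤ b)
    (hT : 0 ≤ T) :
    velocityAmplitude M L K ε b T ≤ (1 + 2 * M + L + 3 * K * M) * (1 + T) * (b + ε) := by
  have hslack : 0 ≤ (b + ε) * T * (1 + 2 * M) + (b + ε) * (L + 3 * K * M) +
      b * (2 * M + T * (L + 3 * K * M)) + ε := by positivity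
  unfold velocityAmplitude
  linarith

theorem stiff_prefactor_le (hM : 0 ≤ M) (hL : 0 ≤ L) (hK : 0 ≤ K) (hA : 0 ≤ A) (hT : 0 ≤ T)
    (hb : 0 ≤ b) (hε : 0 < ε) (hτ : 0 ≤ τ) (hQ₀ : 0 ≤ Q) (hQ : Q ≤ A * (1 + T) * (b + ε))
    (hN : (b + ε) * (1 + ε ^ 2) ≤ N) :
    T * (τ * (2 * L + 2 * K * M + M / ε ^ 2 + (2 * K / ε + 1 / ε ^ 3) * Q)) ≤
      (2 * L + 2 * K * M + M + (2 * K + 1) * A) * ((1 + T) ^ 2 * (τ / ε ^ 3 * N)) := by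
  have hN₀ : 0 ≤ N := le_trans (by positivity) hN
  have hN_le : N ≤ (1 + T) * N := le_mul_of_one_le_left hN₀ (by linarith)
  have hε_le : ε ≤ (1 + T) * N := by linarith [show 0 ≤ b * (1 + ε ^ 2) + ε ^ 3 by positivity]
  have hε_cube_le : ε ^ 3 ≤ (1 + T) * N := by
    linarith [show 0 ≤ b * (1 + ε ^ 2) by positivity]
  have hQ_le : (2 * K * ε ^ 2 + 1) * Q ≤ (2 * K + 1) * A * ((1 + T) * N) :=
    calc _ ≤ (2 * K + 1) * (1 + ε ^ 2) * (A * (1 + T) * (b + ε)) :=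
          mul_le_mul (by linarith [show 0 ≤ 2 * K + ε ^ 2 by positivity]) hQ hQ₀ (by positivity)
      _ = (2 * K + 1) * A * ((1 + T) * ((b + ε) * (1 + ε ^ 2))) := by ring
      _ ≤ _ := by gcongr
  generalize hP : (1 + T) * N = P at *
  have hP₀ : 0 ≤ P := hN₀.trans hN_le
  calc _ = T * (τ / ε ^ 3) *
        ((2 * L + 2 * K * M) * ε ^ 3 + M * ε + (2 * K * ε ^ 2 + 1) * Q) := by field_simp
    _ ≤ (1 + T) * (τ / ε ^ 3) *
        ((2 * L + 2 * K * M) * P + M * P + (2 * K + 1) * A * P) :=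
        mul_le_mul (by gcongr; linarith) (by gcongr) (by positivity) (by positivity)
    _ = _ := by rw [← hP]; ring

theorem uniform_prefactor_le (hM : 0 ≤ M) (hL : 0 ≤ L) (hK : 0 ≤ K) (hT : 0 ≤ T) (hε : 0 ≤ ε)
    (hτ : 0 ≤ τ) (hτD : τ ≤ D) (hQ₀ : 0 ≤ Q) (hQ : ε * Q ≤ A * (1 + T) * D) :
    T * (τ * (L + K * M) + 2 * K * ε * Q) + 2 * (ε * Q) ≤
      (L + K * M + 2 * (K + 1) * A) * ((1 + T) ^ 2 * D) := by
  have hT_le : T ≤ (1 + T) ^ 2 := by linarith [sq_nonneg T]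
  have hKT : K * T + 1 ≤ (K + 1) * (1 + T) := by linarith
  calc _ = (L + K * M) * (T * τ) + 2 * ((K * T + 1) * (ε * Q)) := by ring
    _ ≤ (L + K * M) * ((1 + T) ^ 2 * D) + 2 * ((K + 1) * (1 + T) * (A * (1 + T) * D)) := by
        gcongr ?_ * ?_ + 2 * ?_
        · exact mul_le_mul hT_le hτD hτ (by positivity)
        · exact mul_le_mul hKT hQ (by positivity) (by positivity)
    _ = _ := by ring

theorem pow_three_mul_le_weight (hA : 0 ≤ A) (hT : 0 ≤ T) (hε : 0 ≤ ε) (hτ : 0 ≤ τ)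
    (hQ : Q ≤ A * (1 + T) * (b + ε)) :
    ε ^ 3 * Q ≤ A * (1 + T) * (2 * ((1 + b ^ 2 + ε ^ 2) * (τ + ε ^ 2))) := by
  have hb : ε * (b + ε) ≤ 2 * (1 + b ^ 2 + ε ^ 2) := by
    linarith [sq_nonneg (b - ε), sq_nonneg b, sq_nonneg ε]
  calc _ ≤ ε ^ 3 * (A * (1 + T) * (b + ε)) := by gcongr
    _ = A * (1 + T) * (ε * (b + ε) * ε ^ 2) := by ring
    _ ≤ A * (1 + T) * (2 * (1 + b ^ 2 + ε ^ 2) * (τ + ε ^ 2)) :=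
        mul_le_mul_of_nonneg_left (mul_le_mul hb (by linarith) (by positivity) (by positivity))
          (by positivity)
    _ = _ := by ring

theorem sq_mul_sq_le_weight (hT : 0 ≤ T) (hτ : 0 ≤ τ) (hQ₀ : 0 ≤ Q)
    (hQ : Q ≤ A * (1 + T) * (b + ε)) :
    ε ^ 2 * Q ^ 2 ≤ A ^ 2 * (1 + T) ^ 2 * (2 * ((1 + b ^ 2 + ε ^ 2) * (τ + ε ^ 2))) := by
  have hb : (b + ε) ^ 2 ≤ 2 * (1 + b ^ 2 + ε ^ 2) := by linarith [sq_nonneg (b - ε)]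
  calc _ ≤ ε ^ 2 * (A * (1 + T) * (b + ε)) ^ 2 := by gcongr
    _ = A ^ 2 * (1 + T) ^ 2 * ((b + ε) ^ 2 * ε ^ 2) := by ring
    _ ≤ A ^ 2 * (1 + T) ^ 2 * (2 * (1 + b ^ 2 + ε ^ 2) * (τ + ε ^ 2)) :=
        mul_le_mul_of_nonneg_left (mul_le_mul hb (by linarith) (by positivity) (by positivity))
          (by positivity)
    _ = _ := by ring

theorem averagingError_le (hM : 0 ≤ M) (hK : 0 ≤ K) (hH : 0 ≤ H) (hA : 0 ≤ A) (hT : 0 ≤ T)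
    (hD : ε ^ 2 ≤ D) (hQ : ε ^ 3 * Q ≤ A * (1 + T) * D)
    (hQsq : ε ^ 2 * Q ^ 2 ≤ A ^ 2 * (1 + T) ^ 2 * D) :
    averagingError M K H ε Q ≤ (2 + K * M + H * A ^ 2 + H * (1 + M) * A) * ((1 + T) ^ 2 * D) := by
  have hD₀ : 0 ≤ D := (sq_nonneg ε).trans hD
  have hD' : ε ^ 2 ≤ (1 + T) ^ 2 * D :=
    hD.trans (le_mul_of_one_le_left hD₀ (one_le_pow₀ (by linarith)))
  have hQ' : ε ^ 3 * Q ≤ A * (1 + T) ^ 2 * D :=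
    hQ.trans (by gcongr; exact le_self_pow₀ (by linarith) two_ne_zero)
  calc _ = (2 + K * M) * ε ^ 2 + H * (ε ^ 2 * Q ^ 2) + H * (1 + M) * (ε ^ 3 * Q) := by
        rw [averagingError]; ring
    _ ≤ (2 + K * M) * ((1 + T) ^ 2 * D) + H * (A ^ 2 * (1 + T) ^ 2 * D) +
        H * (1 + M) * (A * (1 + T) ^ 2 * D) := by
        gcongr ?_ * ?_ + ?_ * ?_ + ?_ * ?_
    _ = _ := by ring

theorem uniform_prefactor_le_sq (hM : 0 ≤ M) (hL : 0 ≤ L) (hK : 0 ≤ K) (hH : 0 ≤ H) (hA : 0 ≤ A)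
    (hT : 0 ≤ T) (hε : 0 ≤ ε) (hQ₀ : 0 ≤ Q) (hτ : 0 ≤ τ) (hτD : τ ≤ D) (hεD : ε ^ 2 ≤ D)
    (hQ : ε ^ 3 * Q ≤ A * (1 + T) * D) (hQsq : ε ^ 2 * Q ^ 2 ≤ A ^ 2 * (1 + T) ^ 2 * D) :
    T * (τ * (L + K * M) + 2 * averagingError M K H ε Q) +
        2 * K * (1 + K * T) * (ε ^ 3 * Q) ≤
      (L + K * M + 2 * (2 + K * M + H * A ^ 2 + H * (1 + M) * A) + 2 * K * (1 + K) * A) *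
        ((1 + T) ^ 3 * D) := by
  have hD : 0 ≤ D := hτ.trans hτD
  have hτD' : τ ≤ (1 + T) ^ 2 * D :=
    hτD.trans (le_mul_of_one_le_left hD (one_le_pow₀ (by linarith)))
  have hQ' : ε ^ 3 * Q ≤ A * (1 + T) ^ 2 * D :=
    hQ.trans (by gcongr; exact le_self_pow₀ (by linarith) two_ne_zero)
  have haveraging := averagingError_le hM hK hH hA hT hεD hQ hQsq
  have haveraging₀ : 0 ≤ averagingError M K H ε Q := by unfold averagingError; positivity
  have hKT : 1 + K * T ≤ (1 + K) * (1 + T) := by linarith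
  calc _ ≤ (1 + T) * ((1 + T) ^ 2 * D * (L + K * M) +
          2 * ((2 + K * M + H * A ^ 2 + H * (1 + M) * A) * ((1 + T) ^ 2 * D))) +
        2 * K * ((1 + K) * (1 + T)) * (A * (1 + T) ^ 2 * D) := by
        refine add_le_add (mul_le_mul (by linarith) ?_ (by positivity) (by positivity))
          (mul_le_mul (by gcongr) hQ' (by positivity) (by positivity))
        exact add_le_add (mul_le_mul_of_nonneg_right hτD' (by positivity)) (by linarith)
    _ = _ := by ring

theorem one_add_pow_le {m n : ℕ} (hT : 0 ≤ T) (hmn : m ≤ n) :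
    (1 + T) ^ m ≤ 2 ^ (n - 1) * (1 + T ^ n) :=
  (pow_le_pow_right₀ (by linarith) hmn).trans
    ((add_pow_le zero_le_one hT n).trans_eq (by rw [one_pow]))

theorem exp_le_exp_growth {r : ℝ} (hK : 0 ≤ K) (hT : 0 ≤ T) (hτ : 0 ≤ τ) (hr : r ≤ 2 * K * T) :
    Real.exp r ≤ Real.exp ((2 + K * τ) * K * T) :=
  Real.exp_le_exp.2 (by linarith [show 0 ≤ K * τ * K * T by positivity])

theorem le_add_mul_min {r C₁ C₂ P a b : ℝ} (hC₁ : 0 ≤ C₁) (hC₂ : 0 ≤ C₂) (hP : 0 ≤ P) (ha : 0 ≤ a)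
    (hb : 0 ≤ b) (h₁ : r ≤ C₁ * (P * a)) (h₂ : r ≤ C₂ * (P * b)) :
    r ≤ (C₁ + C₂) * (P * min a b) := by
  rw [add_mul]
  rcases min_choice a b with h | h <;> rw [h]
  · exact h₁.trans (le_add_of_nonneg_right (by positivity))
  · exact h₂.trans (le_add_of_nonneg_left (by positivity))

end UniformConstants

section ErrorEstimates

variable {E e : SpaceTime → Plane} {M L K H N ε τ : ℝ} {x₀ v₀ : Plane} {x v : ℝ → Plane}
  {yd vd : ℕ → Plane} {n m : ℕ}

theorem IsScheme.phaseError_le_stiff (hd : IsScheme E ε τ x₀ v₀ yd vd) (hE : IsLipField E M L K)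
    (h : IsCharacteristic E ε x₀ v₀ x v) (hε : 0 < ε) (hτ : 0 < τ)
    (hN : (‖v₀‖ + ε) * (1 + ε ^ 2) ≤ N) (hm : 2 ≤ m) :
    phaseError ε τ x v yd vd n ≤
      (2 * L + 2 * K * M + M + (2 * K + 1) * (1 + 2 * M + L + 3 * K * M)) *
        (2 ^ (m - 1) * (1 + (n * τ) ^ m) * (τ / ε ^ 3 * N)) *
        Real.exp ((2 + K * τ) * K * (n * τ)) := by
  have hM := hE.M_nonneg
  have hL := hE.L_nonneg
  have hK := hE.K_nonneg
  have hT : (0 : ℝ) ≤ n * τ := by positivity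
  have hN₀ : 0 ≤ N := le_trans (by positivity) hN
  refine (hd.phaseError_le hE h hε hτ n).trans (mul_le_mul
    ((stiff_prefactor_le hM hL hK (by positivity) hT (norm_nonneg v₀) hε hτ.le
      (velocityAmplitude_nonneg hM hL hK hε.le (norm_nonneg v₀) hT)
      (velocityAmplitude_le hM hL hK hε.le (norm_nonneg v₀) hT) hN).trans ?_)
    (exp_le_exp_growth hK hT hτ.le le_rfl) (Real.exp_pos _).le (by positivity))
  gcongr
  exact one_add_pow_le hT hm

theorem IsScheme.norm_x_error_le_uniform (hd : IsScheme E ε τ x₀ v₀ yd vd)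
    (hE : IsLipField E M L K) (h : IsCharacteristic E ε x₀ v₀ x v) (hε : 0 < ε) (hτ : 0 < τ) :
    ‖yd n + ε • perp (vd n) - x (n * τ)‖ ≤
      (L + K * M + 2 * (K + 1) * (1 + 2 * M + L + 3 * K * M)) *
        (4 * (1 + (n * τ) ^ 3) * ((1 + ‖v₀‖ + ε) * (τ + ε))) *
        Real.exp ((2 + K * τ) * K * (n * τ)) := by
  have hM := hE.M_nonneg
  have hL := hE.L_nonneg
  have hK := hE.K_nonneg
  have hT : (0 : ℝ) ≤ n * τ := by positivity
  set Q := velocityAmplitude M L K ε ‖v₀‖ (n * τ)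
  set X := Real.exp ((2 + K * τ) * K * (n * τ))
  have hQ : 0 ≤ Q := velocityAmplitude_nonneg hM hL hK hε.le (norm_nonneg _) hT
  have hQ_le : ε * Q ≤
      (1 + 2 * M + L + 3 * K * M) * (1 + n * τ) * ((1 + ‖v₀‖ + ε) * (τ + ε)) := by
    have hweight : ε * (‖v₀‖ + ε) ≤ (1 + ‖v₀‖ + ε) * (τ + ε) := by
      linarith [show 0 ≤ (1 + ‖v₀‖ + ε) * τ by positivity]
    calc _ ≤ ε * ((1 + 2 * M + L + 3 * K * M) * (1 + n * τ) * (‖v₀‖ + ε)) := by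
          gcongr
          exact velocityAmplitude_le hM hL hK hε.le (norm_nonneg v₀) hT
      _ = (1 + 2 * M + L + 3 * K * M) * (1 + n * τ) * (ε * (‖v₀‖ + ε)) := by ring
      _ ≤ _ := mul_le_mul_of_nonneg_left hweight (by positivity)
  have hX : Real.exp (K * (n * τ)) ≤ X :=
    exp_le_exp_growth hK hT hτ.le (by linarith [mul_nonneg hK hT])
  have hv : ‖vd n - v (n * τ)‖ ≤ Q * X + Q * X := norm_sub_le_of_le
    ((hd.norm_v_le_of_le hE hε hτ le_rfl).trans (by gcongr))
    ((h.norm_v_le_of_le hE hε hT le_rfl le_rfl).trans (by gcongr))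
  calc _ ≤ n * τ * (τ * (L + K * M) + 2 * K * ε * Q) * X + ε * (Q * X + Q * X) :=
        (norm_x_error_le_phaseError hε.le x v yd vd n).trans (add_le_add
          ((hd.guidingCenterError_le hE h hε hτ n).trans (by gcongr)) (by gcongr))
    _ = (n * τ * (τ * (L + K * M) + 2 * K * ε * Q) + 2 * (ε * Q)) * X := by ring
    _ ≤ (L + K * M + 2 * (K + 1) * (1 + 2 * M + L + 3 * K * M)) *
        ((1 + n * τ) ^ 2 * ((1 + ‖v₀‖ + ε) * (τ + ε))) * X := by
        gcongr
        refine uniform_prefactor_le hM hL hK hT hε.le hτ.le ?_ hQ hQ_le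
        linarith [show 0 ≤ (‖v₀‖ + ε) * (τ + ε) by positivity]
    _ ≤ _ := by
        gcongr
        exact (one_add_pow_le hT (Nat.le_succ 2)).trans_eq (by norm_num)

theorem space_error_estimate (hE : IsLipField E M L K) :
    ∃ C : ℝ, ∀ ε Δt : ℝ, 0 < ε → 0 < Δt → ∀ x₀ v₀ : Plane,
      ∀ x v : ℝ → Plane, IsCharacteristic E ε x₀ v₀ x v →
      ∀ yd vd : ℕ → Plane, IsScheme E ε Δt x₀ v₀ yd vd → ∀ n : ℕ,
        ‖(yd n + ε • perp (vd n)) - x (n * Δt)‖ ≤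
          C * ((1 + (n * Δt) ^ 3) * Real.exp ((2 + K * Δt) * K * (n * Δt)) *
            (1 + ‖v₀‖ + ε) * min (Δt / ε ^ 3 * (1 + ε ^ 2)) (Δt + ε)) := by
  have hM := hE.M_nonneg
  have hL := hE.L_nonneg
  have hK := hE.K_nonneg
  set A := 1 + 2 * M + L + 3 * K * M
  refine ⟨4 * (2 * L + 2 * K * M + M + (2 * K + 1) * A) + 4 * (L + K * M + 2 * (K + 1) * A),
    fun ε τ hε hτ x₀ v₀ x v h yd vd hd n => le_add_mul_min (by positivity) (by positivity)
      (by positivity) (by positivity) (by positivity) ?_ ?_⟩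
  · have hstiff := hd.phaseError_le_stiff (n := n) hE h hε hτ (m := 3)
      (N := (1 + ‖v₀‖ + ε) * (1 + ε ^ 2)) (by gcongr; linarith) (by norm_num)
    exact (norm_x_error_le_phaseError hε.le x v yd vd n).trans (hstiff.trans_eq (by ring))
  · exact (hd.norm_x_error_le_uniform hE h hε hτ).trans_eq (by ring)

theorem IsScheme.guidingCenterError_le_uniform_sq (hd : IsScheme E ε τ x₀ v₀ yd vd)
    (hE : IsLipField E M L K) (h : IsCharacteristic E ε x₀ v₀ x v)
    (he : IsSmoothApprox E e K H (ε ^ 2)) (hε : 0 < ε) (hτ : 0 < τ) {A : ℝ}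
    (hA : A = 1 + 2 * M + L + 3 * K * M) :
    ‖yd n - guidingCenter ε x v (n * τ)‖ ≤
      (L + K * M + 2 * (2 + K * M + H * A ^ 2 + H * (1 + M) * A) + 2 * K * (1 + K) * A) *
        (8 * (1 + (n * τ) ^ 4) * (2 * ((1 + ‖v₀‖ ^ 2 + ε ^ 2) * (τ + ε ^ 2)))) *
        Real.exp ((2 + K * τ) * K * (n * τ)) := by
  have hM := hE.M_nonneg
  have hL := hE.L_nonneg
  have hK := hE.K_nonneg
  have hH := he.H_nonneg
  have hA₀ : 0 ≤ A := by rw [hA]; positivity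
  have hT : (0 : ℝ) ≤ n * τ := by positivity
  have hb₀ : 0 ≤ ‖v₀‖ := norm_nonneg v₀
  set b := ‖v₀‖
  set T := n * τ
  set D := 2 * ((1 + b ^ 2 + ε ^ 2) * (τ + ε ^ 2))
  set Q := velocityAmplitude M L K ε b T
  have hQ₀ : 0 ≤ Q := velocityAmplitude_nonneg hM hL hK hε.le hb₀ hT
  have hQ : Q ≤ A * (1 + T) * (b + ε) := hA ▸ velocityAmplitude_le hM hL hK hε.le hb₀ hT
  have hsum : τ + ε ^ 2 ≤ D := by
    linarith [show 0 ≤ τ + ε ^ 2 + 2 * (b ^ 2 + ε ^ 2) * (τ + ε ^ 2) by positivity]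
  have hτD : τ ≤ D := by linarith [sq_nonneg ε]
  have hεD : ε ^ 2 ≤ D := by linarith
  have hcubic : ε ^ 3 * Q ≤ A * (1 + T) * D :=
    pow_three_mul_le_weight hA₀ hT hε.le hτ.le hQ
  have hquadratic : ε ^ 2 * Q ^ 2 ≤ A ^ 2 * (1 + T) ^ 2 * D :=
    sq_mul_sq_le_weight hT hτ.le hQ₀ hQ
  refine (hd.guidingCenterError_le_sq hE h he hε hτ n).trans (mul_le_mul
    ((uniform_prefactor_le_sq hM hL hK hH hA₀ hT hε.le hQ₀ hτ.le hτD hεD hcubic hquadratic).trans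
      ?_) (exp_le_exp_growth hK hT hτ.le le_rfl) (Real.exp_pos _).le (by positivity))
  gcongr
  exact (one_add_pow_le hT (Nat.le_succ 3)).trans_eq (by norm_num)

theorem guidingCenter_error_estimate (hE : IsLipField E M L K)
    (happrox : ∀ δ > 0, ∃ e, IsSmoothApprox E e K H δ) :
    ∃ C : ℝ, ∀ ε Δt : ℝ, 0 < ε → 0 < Δt → ∀ x₀ v₀ : Plane,
      ∀ x v : ℝ → Plane, IsCharacteristic E ε x₀ v₀ x v →
      ∀ yd vd : ℕ → Plane, IsScheme E ε Δt x₀ v₀ yd vd → ∀ n : ℕ,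
        ‖yd n - guidingCenter ε x v (n * Δt)‖ ≤
          C * ((1 + (n * Δt) ^ 4) * Real.exp ((2 + K * Δt) * K * (n * Δt)) *
            (1 + ‖v₀‖ ^ 2 + ε ^ 2) * min (Δt / ε ^ 3 * (1 + ε)) (Δt + ε ^ 2)) := by
  have hM := hE.M_nonneg
  have hL := hE.L_nonneg
  have hK := hE.K_nonneg
  have hH : 0 ≤ H := (happrox 1 one_pos).elim fun _ he => he.H_nonneg
  set A := 1 + 2 * M + L + 3 * K * M with hA
  refine ⟨16 * (2 * L + 2 * K * M + M + (2 * K + 1) * A) + 16 * (L + K * M +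
    2 * (2 + K * M + H * A ^ 2 + H * (1 + M) * A) + 2 * K * (1 + K) * A),
    fun ε τ hε hτ x₀ v₀ x v h yd vd hd n => le_add_mul_min (by positivity) (by positivity)
      (by positivity) (by positivity) (by positivity) ?_ ?_⟩
  · have hN : (‖v₀‖ + ε) * (1 + ε ^ 2) ≤ 2 * ((1 + ‖v₀‖ ^ 2 + ε ^ 2) * (1 + ε)) := by
      nlinarith [sq_nonneg (‖v₀‖ - 1), mul_nonneg hε.le (sq_nonneg (‖v₀‖ - ε)),
        mul_nonneg hε.le (sq_nonneg ‖v₀‖), pow_pos hε 3]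
    have hstiff := hd.phaseError_le_stiff (n := n) hE h hε hτ hN (m := 4) (by norm_num)
    exact (le_add_of_nonneg_right (by positivity)).trans (hstiff.trans_eq (by ring))
  · obtain ⟨e, he⟩ := happrox (ε ^ 2) (by positivity)
    exact (hd.guidingCenterError_le_uniform_sq hE h he hε hτ hA).trans_eq (by ring)

end ErrorEstimates

theorem theorem4p1 (E : SpaceTime → Plane) :
    -- unique solvability of the scheme
    (∀ ε Δt : ℝ, 0 < ε → 0 < Δt → ∀ x₀ v₀ : Plane,
      ∃! p : (ℕ → Plane) × (ℕ → Plane), IsScheme E ε Δt x₀ v₀ p.1 p.2) ∧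
    -- error on the space variable `x = y + ε v^⊥`
    (IsSobolevField 1 E → ∃ C : ℝ, ∀ ε Δt : ℝ, 0 < ε → 0 < Δt → ∀ x₀ v₀ : Plane,
      ∀ x v : ℝ → Plane, IsCharacteristic E ε x₀ v₀ x v →
      ∀ yd vd : ℕ → Plane, IsScheme E ε Δt x₀ v₀ yd vd → ∀ n : ℕ,
        ‖(yd n + ε • perp (vd n)) - x (n * Δt)‖ ≤
          C * ((1 + (n * Δt) ^ 3) * Real.exp ((2 + Kx E * Δt) * Kx E * (n * Δt)) *
            (1 + ‖v₀‖ + ε) * min (Δt / ε ^ 3 * (1 + ε ^ 2)) (Δt + ε))) ∧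
    -- error on the guiding center variable `y = x - ε v^⊥`
    (IsSobolevField 2 E → ∃ C : ℝ, ∀ ε Δt : ℝ, 0 < ε → 0 < Δt → ∀ x₀ v₀ : Plane,
      ∀ x v : ℝ → Plane, IsCharacteristic E ε x₀ v₀ x v →
      ∀ yd vd : ℕ → Plane, IsScheme E ε Δt x₀ v₀ yd vd → ∀ n : ℕ,
        ‖yd n - (x (n * Δt) - ε • perp (v (n * Δt)))‖ ≤
          C * ((1 + (n * Δt) ^ 4) * Real.exp ((2 + Kx E * Δt) * Kx E * (n * Δt)) *
            (1 + ‖v₀‖ ^ 2 + ε ^ 2) * min (Δt / ε ^ 3 * (1 + ε)) (Δt + ε ^ 2))) := by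
  refine ⟨fun ε Δt hε hΔt x₀ v₀ => existsUnique_isScheme E hε hΔt x₀ v₀,
    fun hE => space_error_estimate hE.isLipField, fun hE => ?_⟩
  exact guidingCenter_error_estimate hE.one_of_two.isLipField fun δ hδ =>
    hE.exists_isSmoothApprox hδ
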